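/- Let $d\ge 1$ and let $a,b\in\mathbb R$ satisfy $-d<b<2\le a\le 4$. Let $W:\mathbb R^d\to(-\infty,\infty]$ be the potential $$W(x)=\frac{|x|^a}{a}-\frac{|x|^b}{b},$$ with the convention $\frac{|x|^0}{0}:=\ln|x|$ and with $W(0)=+\infty$ if $b\le 0$. For a finite positive measure $\rho$ on $\mathbb R^d$ let $E[\rho]=\frac12\iint W(x-y)\,d\rho(y)\,d\rho(x)\in(-\infty,\infty]$, and for a finite signed measure $\mu$ with $E[|\mu|]<\infty$ let $E[\mu]=\frac12\iint W(x-y)\,d\mu(y)\,d\mu(x)\in\mathbb R$ and $\hat\mu(\xi)=\int e^{-ix\cdot\xi}\,d\mu(x)$. 1. Unless $d=1$ and $0\le b<1$, the energy $E$ has the Fourier linear interpolation convexity (FLIC) property: for all $0<r<R<\infty$ there is a constant $c>0$ such that $$E[\mu]\ \ge\ c\int_{r\le|\xi|\le R}|\hat\mu(\xi)|^2\,d\xi$$ for every finite signed Borel measure $\mu$ on $\mathbb R^d$ with finite first moment, $\int d\mu=0$, $\int x\,d\mu(x)=0$ and $E[|\mu|]<\infty$. 2. Let $d\ge 2$. For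 compactly supported probability measures $\mu,\nu$ let $d_\infty(\mu,\nu)=\inf_{\pi}\sup_{(x,y)\in\operatorname{supp}\pi}|x-y|$, the infimum being over all transport plans $\pi$ between $\mu$ and $\nu$. Every compactly supported $d_\infty$-local minimizer of $E$, i.e. every compactly supported probability measure $\rho$ for which there is $\varepsilon>0$ with $E[\rho]\le E[\nu]$ for all compactly supported probability measures $\nu$ with $d_\infty(\rho,\nu)<\varepsilon$, is radially symmetric about its center of mass, i.e. invariant under all linear isometries around that point. 3. Let $d\ge 2$. Among the Borel probability measures on $\mathbb R^d$ with finite second moment, $E$ has a global minimizer, it is unique once the center of mass is fixed to be $0$, and every global minimizer is radially symmetric about its center of mass. -/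

import Mathlib

open MeasureTheory
open scoped ENNReal

noncomputable section

namespace InteractionEnergy

/-- The Euclidean space `ℝ^d`. -/
abbrev Rn (d : ℕ) : Type := EuclideanSpace ℝ (Fin d)

/-! ### The power-law potential -/

/-- `r ^ p / p` for `r > 0`, with the convention `r ^ 0 / 0 = log r`. -/
def powerTerm (p r : ℝ) : ℝ := if p = 0 then Real.log r else r ^ p / p

/-- The potential `W(x) = |x|^a / a - |x|^b / b` (used with `a > 0`), as a function
`ℝ^d → (-∞, ∞]`.  For `b ≤ 0` it is singular at the origin, where `W(0) = +∞`. -/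
def powerLaw (d : ℕ) (a b : ℝ) (x : Rn d) : EReal :=
  open Classical in
  if x = 0 ∧ b ≤ 0 then ⊤ else ((powerTerm a ‖x‖ - powerTerm b ‖x‖ : ℝ) : EReal)

/-! ### The interaction energy -/

/-- The energy `E[ρ] = 1/2 ∬ W(x - y) dρ(y) dρ(x)` of a finite positive measure, as the integral of
the positive part minus the integral of the negative part.  The latter is finite if `W` is
bounded below, so that then `E[ρ]` is a well-defined element of `(-∞, ∞]`. -/
def energy {d : ℕ} (W : Rn d → EReal) (ρ : Measure (Rn d)) : EReal :=
  ((1 / 2 : ℝ) : EReal) *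
    (((∫⁻ p : Rn d × Rn d, (W (p.1 - p.2)).toENNReal ∂(ρ.prod ρ) : ℝ≥0∞) : EReal) -
      ((∫⁻ p : Rn d × Rn d, (-W (p.1 - p.2)).toENNReal ∂(ρ.prod ρ) : ℝ≥0∞) : EReal))

/-- `1/2 ∬ W(x - y) dα(x) dβ(y)`, for measures such that `W(x - y)` is integrable (in particular
almost everywhere finite) with respect to `α ⊗ β`. -/
def mutualEnergy {d : ℕ} (W : Rn d → EReal) (α β : Measure (Rn d)) : ℝ :=
  1 / 2 * ∫ p : Rn d × Rn d, (W (p.1 - p.2)).toReal ∂(α.prod β)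

/-- The energy `E[μ] = 1/2 ∬ W(x - y) dμ(y) dμ(x)` of a signed measure `μ = μ⁺ - μ⁻` (Jordan
decomposition), for `μ` with `E[|μ|] < ∞`. -/
def signedEnergy {d : ℕ} (W : Rn d → EReal) (μ : SignedMeasure (Rn d)) : ℝ :=
  let μp := μ.toJordanDecomposition.posPart
  let μn := μ.toJordanDecomposition.negPart
  mutualEnergy W μp μp - mutualEnergy W μp μn - mutualEnergy W μn μp + mutualEnergy W μn μn

/-! ### Fourier linear interpolation convexity -/

/-- The integral `∫ f dμ` of a vector-valued function against a signed measure. -/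
def signedIntegral {d : ℕ} {F : Type} [NormedAddCommGroup F] [NormedSpace ℝ F]
    (μ : SignedMeasure (Rn d)) (f : Rn d → F) : F :=
  ∫ x, f x ∂μ.toJordanDecomposition.posPart - ∫ x, f x ∂μ.toJordanDecomposition.negPart

/-- The Fourier transform `μ̂(ξ) = ∫ exp(-i x·ξ) dμ(x)` of a signed measure. -/
def fourier {d : ℕ} (μ : SignedMeasure (Rn d)) (ξ : Rn d) : ℂ :=
  signedIntegral μ fun x => Complex.exp (-(Complex.I * ((inner ℝ x ξ : ℝ) : ℂ)))

/-- Signed measures with `∫ dμ = 0`, `∫ x dμ = 0` and `E[|μ|] < ∞`. -/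
structure IsAdmissible {d : ℕ} (W : Rn d → EReal) (μ : SignedMeasure (Rn d)) : Prop where
  mass_eq_zero : μ Set.univ = 0
  integrable : Integrable (fun x : Rn d => x) μ.totalVariation
  center_eq_zero : signedIntegral μ (fun x : Rn d => x) = 0
  energy_lt_top : energy W μ.totalVariation < ⊤

/-- Fourier linear interpolation convexity (FLIC) of the interaction energy with potential `W`. -/
def IsFLIC {d : ℕ} (W : Rn d → EReal) : Prop :=
  ∀ r R : ℝ, 0 < r → r < R → ∃ c : ℝ, 0 < c ∧
    ∀ μ : SignedMeasure (Rn d), IsAdmissible W μ →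
      c * ∫ ξ in {ξ : Rn d | r ≤ ‖ξ‖ ∧ ‖ξ‖ ≤ R}, ‖fourier μ ξ‖ ^ 2 ≤ signedEnergy W μ

/-! ### Minimizers and radial symmetry -/

/-- The `∞`-Wasserstein distance: the infimum over all transport plans `π` between `μ` and `ν` of
`sup {|y - x| : (x, y) ∈ supp π}`. -/
def dInfty {d : ℕ} (μ ν : Measure (Rn d)) : ℝ≥0∞ :=
  ⨅ π : Measure (Rn d × Rn d), ⨅ _ : π.fst = μ ∧ π.snd = ν, ⨆ p ∈ π.support, edist p.1 p.2

/-- `ρ` is a compactly supported probability measure which is a local minimizer of the energy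
with respect to `d_∞`. -/
structure IsCompactDInftyLocalMinimizer {d : ℕ} (W : Rn d → EReal) (ρ : Measure (Rn d)) :
    Prop where
  isProbabilityMeasure : IsProbabilityMeasure ρ
  isCompact_support : IsCompact ρ.support
  le_energy : ∃ ε : ℝ, 0 < ε ∧ ∀ ν : Measure (Rn d), IsProbabilityMeasure ν →
    IsCompact ν.support → dInfty ρ ν < ENNReal.ofReal ε → energy W ρ ≤ energy W ν

/-- Probability measures with finite second moment. -/
structure IsProbTwo {d : ℕ} (ρ : Measure (Rn d)) : Prop where
  isProbabilityMeasure : IsProbabilityMeasure ρ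
  second_moment_lt_top : ∫⁻ x, ‖x‖ₑ ^ 2 ∂ρ < ⊤

/-- Global minimizers of the energy over the probability measures with finite second moment. -/
def IsGlobalMinimizer {d : ℕ} (W : Rn d → EReal) (ρ : Measure (Rn d)) : Prop :=
  IsProbTwo ρ ∧ ∀ ν : Measure (Rn d), IsProbTwo ν → energy W ρ ≤ energy W ν

/-- The center of mass of a probability measure. -/
def centerOfMass {d : ℕ} (ρ : Measure (Rn d)) : Rn d := ∫ x, x ∂ρ

/-- `ρ` is radially symmetric (about its center of mass): it is invariant under all linear
isometries around that point. -/
def IsRadiallySymmetric {d : ℕ} (ρ : Measure (Rn d)) : Prop :=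
  ∀ Q : Rn d ≃ₗᵢ[ℝ] Rn d,
    ρ.map (fun x => centerOfMass ρ + Q (x - centerOfMass ρ)) = ρ

end InteractionEnergy

end

/-!
For balanced measures `α`, `β` (equal mass, equal center of mass, finite second moments) write
`D k` for the double integral of `k (x - y)` against `α - β` in both variables (`discrepancy`).
Everything rests on the positivity of `D` for the potential.

For a Gaussian `exp (-t |x| ^ 2)`, `D` is a weighted `L²` norm of `α̂ - β̂` with a positive weight
(`discrepancy_gaussian`).  The functions `|x| ^ a` with `2 < a < 4` and `-|x| ^ b / b` with `b < 2`
are superpositions of Gaussians with a positive weight, up to a constant and a multiple of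
`|x| ^ 2`, which are needed for convergence and to which `D` is insensitive
(`IsGaussianMixture`); the exponent `b = 0` is Frullani's integral, `D` vanishes for `|x| ^ 2`, and
`a = 4` is a limit.  So the attractive part contributes nonnegatively, while the repulsive part
controls `α̂ - β̂` on every ball (`exists_le_discrepancy_regPotential`).  With `α`, `β` the parts of
the Jordan decomposition of a signed measure this is Fourier linear interpolation convexity
(`isFLIC_powerLaw`); the required moments follow from the finiteness of the energy, as `a ≥ 2`.

For two probability measures of finite energy with the same center of mass the mutual energy is
finite as well (`IsBalanced.crossEnergy_lt_top`), and the parallelogram identity turns positivity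
into strict convexity along the segment between them (`eq_of_crossEnergy_le_midpoint`).  Hence
global minimizers with the same center of mass agree, and they are radially symmetric because the
energy is invariant under isometries.  They exist by the direct method: the energy bounds the
variance, so centered minimizing sequences are tight, and the energy is lower semicontinuous, being
a limit from below of energies with continuous potentials.

For a `d_∞`-local minimizer, consider its image under an isometry around the center of mass which
is close to the identity.  The midpoint of the two measures is close in `d_∞`, so strict convexity
shows that the measure is invariant under the isometry.  Consequently its characteristic function,
taken around the center of mass, is locally constant on spheres, which are connected for `d ≥ 2`
(`map_isometry_eq_of_near_identity`).  That a local minimizer has finite energy at all follows by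
comparison with its convolution with the uniform measure on a small ball.
-/

noncomputable section

namespace InteractionEnergy

open Set Filter Topology

variable {d : ℕ}

/-! ### The discrepancy of two measures -/

/-- For measures `α` and `β`, the double integral of `k (x - y)` against the signed measure
`α - β` in both variables.  It is kept as four integrals against positive measures, and is
meaningful if `k (x - y)` is integrable for `(α + β) ⊗ (α + β)`. -/
def discrepancy (k : Rn d → ℝ) (α β : Measure (Rn d)) : ℝ :=
  (∫ p, k (p.1 - p.2) ∂α.prod α - ∫ p, k (p.1 - p.2) ∂α.prod β) -
    (∫ p, k (p.1 - p.2) ∂β.prod α - ∫ p, k (p.1 - p.2) ∂β.prod β)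

/-- Two measures with the same mass, the same center of mass and finite second moments. -/
structure IsBalanced (α β : Measure (Rn d)) : Prop where
  mass_eq : α univ = β univ
  left_sq : Integrable (fun x : Rn d => ‖x‖ ^ 2) α
  right_sq : Integrable (fun x : Rn d => ‖x‖ ^ 2) β
  mean_eq : ∫ x, x ∂α = ∫ x, x ∂β

theorem discrepancy_const_mul (c : ℝ) (k : Rn d → ℝ) (α β : Measure (Rn d)) :
    discrepancy (fun x => c * k x) α β = c * discrepancy k α β := by
  simp only [discrepancy, integral_const_mul]
  ring

section prod

variable {α β : Measure (Rn d)} [IsFiniteMeasure α] [IsFiniteMeasure β]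

theorem integrable_add_prod_add_iff {F : Type*} [NormedAddCommGroup F] {f : Rn d × Rn d → F} :
    Integrable f ((α + β).prod (α + β)) ↔
      (Integrable f (α.prod α) ∧ Integrable f (α.prod β)) ∧
        (Integrable f (β.prod α) ∧ Integrable f (β.prod β)) := by
  rw [Measure.prod_add, Measure.add_prod, Measure.add_prod, integrable_add_measure,
    integrable_add_measure, integrable_add_measure]
  tauto

theorem discrepancy_add {k l : Rn d → ℝ}
    (hk : Integrable (fun p : Rn d × Rn d => k (p.1 - p.2)) ((α + β).prod (α + β)))
    (hl : Integrable (fun p : Rn d × Rn d => l (p.1 - p.2)) ((α + β).prod (α + β))) :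
    discrepancy (fun x => k x + l x) α β = discrepancy k α β + discrepancy l α β := by
  rw [integrable_add_prod_add_iff] at hk hl
  obtain ⟨⟨h1, h2⟩, h3, h4⟩ := hk
  obtain ⟨⟨g1, g2⟩, g3, g4⟩ := hl
  simp only [discrepancy]
  rw [integral_add h1 g1, integral_add h2 g2, integral_add h3 g3, integral_add h4 g4]
  ring

theorem discrepancy_const (h : α univ = β univ) (c : ℝ) :
    discrepancy (fun _ => c) α β = 0 := by
  have h' : α.real univ = β.real univ := by simp [Measure.real, h]
  simp only [discrepancy, integral_const, Measure.real, ← univ_prod_univ, Measure.prod_prod, h]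
  ring

theorem integrable_norm_sq_sub (hα : Integrable (fun x : Rn d => ‖x‖ ^ 2) α)
    (hβ : Integrable (fun x : Rn d => ‖x‖ ^ 2) β) :
    Integrable (fun p : Rn d × Rn d => ‖p.1 - p.2‖ ^ 2) (α.prod β) := by
  have h1 : Integrable (fun p : Rn d × Rn d => ‖p.1‖ ^ 2) (α.prod β) := hα.comp_fst β
  have h2 : Integrable (fun p : Rn d × Rn d => ‖p.2‖ ^ 2) (α.prod β) := hβ.comp_snd α
  refine ((h1.add h2).const_mul 2).mono' (by fun_prop) (ae_of_all _ fun p => ?_)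
  have := norm_sub_le p.1 p.2
  rw [Real.norm_of_nonneg (by positivity)]
  simp only [Pi.add_apply]
  nlinarith [norm_nonneg (p.1 - p.2), sq_nonneg (‖p.1‖ - ‖p.2‖)]

theorem integrable_id_of_norm_sq (hα : Integrable (fun x : Rn d => ‖x‖ ^ 2) α) :
    Integrable (fun x : Rn d => x) α := by
  refine ((integrable_const (1 : ℝ)).add hα).mono' (by fun_prop) (ae_of_all _ fun x => ?_)
  simp only [Pi.add_apply]
  nlinarith [sq_nonneg (‖x‖ - 1)]

theorem integral_norm_sq_sub (hα : Integrable (fun x : Rn d => ‖x‖ ^ 2) α)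
    (hβ : Integrable (fun x : Rn d => ‖x‖ ^ 2) β) :
    ∫ p, ‖p.1 - p.2‖ ^ 2 ∂α.prod β = β.real univ * ∫ x, ‖x‖ ^ 2 ∂α + α.real univ * ∫ x, ‖x‖ ^ 2 ∂β
      - 2 * inner ℝ (∫ x, x ∂α) (∫ x, x ∂β) := by
  have h1 : Integrable (fun p : Rn d × Rn d => ‖p.1‖ ^ 2) (α.prod β) := hα.comp_fst β
  have h2 : Integrable (fun p : Rn d × Rn d => ‖p.2‖ ^ 2) (α.prod β) := hβ.comp_snd α
  have iα := integrable_id_of_norm_sq hα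
  have iβ := integrable_id_of_norm_sq hβ
  have h3 : Integrable (fun p : Rn d × Rn d => (inner ℝ p.1 p.2 : ℝ)) (α.prod β) := by
    refine (iα.norm.mul_prod iβ.norm).mono' (by fun_prop) (ae_of_all _ fun p => ?_)
    exact norm_inner_le_norm _ _
  have e : ∀ p : Rn d × Rn d, ‖p.1 - p.2‖ ^ 2 = ‖p.1‖ ^ 2 + ‖p.2‖ ^ 2 - 2 * inner ℝ p.1 p.2 := by
    intro p
    rw [norm_sub_sq_real]
    ring
  simp_rw [e]
  rw [integral_sub (by exact h1.add h2) (h3.const_mul 2), integral_add h1 h2, integral_const_mul,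
    integral_fun_fst (fun x : Rn d => ‖x‖ ^ 2), integral_fun_snd (fun x : Rn d => ‖x‖ ^ 2),
    integral_prod _ h3]
  have e3 : ∀ x : Rn d, ∫ y, (inner ℝ x y : ℝ) ∂β = inner ℝ x (∫ y, y ∂β) := fun x =>
    integral_inner iβ x
  have e4 : ∫ x, (inner ℝ x (∫ y, y ∂β) : ℝ) ∂α = inner ℝ (∫ x, x ∂α) (∫ y, y ∂β) := by
    simp_rw [real_inner_comm (∫ y, y ∂β)]
    rw [integral_inner iα]
  simp_rw [e3]
  rw [e4]
  simp

theorem IsBalanced.integrable_norm_sq_sub (h : IsBalanced α β) :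
    Integrable (fun p : Rn d × Rn d => ‖p.1 - p.2‖ ^ 2) ((α + β).prod (α + β)) :=
  InteractionEnergy.integrable_norm_sq_sub (h.left_sq.add_measure h.right_sq)
    (h.left_sq.add_measure h.right_sq)

theorem IsBalanced.discrepancy_norm_sq (h : IsBalanced α β) :
    discrepancy (fun x => ‖x‖ ^ 2) α β = 0 := by
  have h' : α.real univ = β.real univ := by simp [Measure.real, h.mass_eq]
  simp only [discrepancy]
  rw [integral_norm_sq_sub h.left_sq h.left_sq, integral_norm_sq_sub h.left_sq h.right_sq,
    integral_norm_sq_sub h.right_sq h.left_sq, integral_norm_sq_sub h.right_sq h.right_sq,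
    h.mean_eq, h']
  ring

/-! ### Gaussian kernels -/

theorem integrable_gaussian_sub {t : ℝ} (ht : 0 ≤ t) :
    Integrable (fun p : Rn d × Rn d => Real.exp (-t * ‖p.1 - p.2‖ ^ 2)) (α.prod β) := by
  refine (integrable_const (1 : ℝ)).mono' (by fun_prop) (ae_of_all _ fun p => ?_)
  rw [Real.norm_of_nonneg (by positivity), Real.exp_le_one_iff]
  nlinarith [sq_nonneg ‖p.1 - p.2‖]

theorem integrable_exp_neg_sq_div {t : ℝ} (ht : 0 < t) :
    Integrable (fun v : Rn d => Real.exp (-‖v‖ ^ 2 / (4 * t))) := by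
  have h := (GaussianFourier.integrable_cexp_neg_mul_sq_norm_add (V := Rn d)
    (b := ((1 / (4 * t) : ℝ) : ℂ)) (by rw [Complex.ofReal_re]; positivity) 0 0).norm
  refine h.congr (ae_of_all _ fun v => ?_)
  simp only [Complex.norm_exp]
  congr 1
  simp only [zero_mul, add_zero]
  norm_cast
  ring

theorem integral_gaussian_mul_char {t : ℝ} (ht : 0 < t) (x : Rn d) :
    ∫ v : Rn d, (Real.exp (-‖v‖ ^ 2 / (4 * t)) : ℂ) * Complex.exp ((inner ℝ x v : ℝ) * Complex.I) =
      (((4 * Real.pi * t) ^ (d / 2 : ℝ) * Real.exp (-t * ‖x‖ ^ 2) : ℝ) : ℂ) := by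
  have h := GaussianFourier.integral_cexp_neg_mul_sq_norm_add (V := Rn d)
    (b := ((1 / (4 * t) : ℝ) : ℂ)) (by rw [Complex.ofReal_re]; positivity) Complex.I x
  have e : ∀ v : Rn d, (Real.exp (-‖v‖ ^ 2 / (4 * t)) : ℂ) *
      Complex.exp ((inner ℝ x v : ℝ) * Complex.I) =
      Complex.exp (-((1 / (4 * t) : ℝ) : ℂ) * ‖v‖ ^ 2 + Complex.I * (inner ℝ x v : ℝ)) := by
    intro v
    rw [Complex.ofReal_exp, ← Complex.exp_add]
    congr 1
    push_cast
    ring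
  simp_rw [e]
  rw [h]
  push_cast
  rw [Complex.ofReal_cpow (by positivity)]
  congr 1
  · push_cast
    congr 1
    · field_simp
    · simp
  · congr 1
    rw [Complex.I_sq]
    have : (t : ℂ) ≠ 0 := by exact_mod_cast ht.ne'
    field_simp

/-- The interaction of two measures through a Gaussian, on the Fourier side. -/
theorem integral_gaussian_sub {t : ℝ} (ht : 0 < t) :
    ((((4 * Real.pi * t) ^ (d / 2 : ℝ) *
      ∫ p, Real.exp (-t * ‖p.1 - p.2‖ ^ 2) ∂α.prod β : ℝ)) : ℂ) =
      ∫ v : Rn d, (Real.exp (-‖v‖ ^ 2 / (4 * t)) : ℂ) *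
        (charFun α v * (starRingEnd ℂ) (charFun β v)) := by
  have hI : Integrable (fun z : (Rn d) × (Rn d × Rn d) =>
      (Real.exp (-‖z.1‖ ^ 2 / (4 * t)) : ℂ) *
        Complex.exp ((inner ℝ (z.2.1 - z.2.2) z.1 : ℝ) * Complex.I))
      (volume.prod (α.prod β)) := by
    have := (integrable_exp_neg_sq_div (d := d) ht).comp_fst (α.prod β)
    refine this.mono' (by fun_prop) (ae_of_all _ fun z => ?_)
    rw [norm_mul, Complex.norm_exp_ofReal_mul_I, mul_one, Complex.norm_real,
      Real.norm_of_nonneg (by positivity)]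
  have e1 : ∀ v : Rn d, (Real.exp (-‖v‖ ^ 2 / (4 * t)) : ℂ) *
        (charFun α v * (starRingEnd ℂ) (charFun β v)) =
      ∫ p : Rn d × Rn d, (Real.exp (-‖v‖ ^ 2 / (4 * t)) : ℂ) *
        Complex.exp ((inner ℝ (p.1 - p.2) v : ℝ) * Complex.I) ∂α.prod β := by
    intro v
    rw [integral_const_mul, charFun_apply, charFun_apply, ← integral_conj, ← integral_prod_mul]
    congr 1
    refine integral_congr_ae (ae_of_all _ fun p => ?_)
    simp only
    rw [← Complex.exp_conj, ← Complex.exp_add, inner_sub_left]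
    congr 1
    simp
    ring
  simp_rw [e1]
  rw [integral_integral_swap hI]
  simp_rw [integral_gaussian_mul_char ht]
  rw [integral_complex_ofReal, integral_const_mul]

theorem integrable_gaussian_mul_charFun {t : ℝ} (ht : 0 < t) :
    Integrable (fun v : Rn d => (Real.exp (-‖v‖ ^ 2 / (4 * t)) : ℂ) *
        (charFun α v * (starRingEnd ℂ) (charFun β v))) := by
  refine ((integrable_exp_neg_sq_div (d := d) ht).mul_const
    (α.real univ * β.real univ)).mono' ?_ (ae_of_all _ fun v => ?_)
  · have h1 : Measurable (charFun α) := measurable_charFun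
    have h2 : Measurable (charFun β) := measurable_charFun
    have h3 : Measurable fun v => (starRingEnd ℂ) (charFun β v) :=
      Complex.continuous_conj.measurable.comp h2
    have h4 : Measurable fun v : Rn d => (Real.exp (-‖v‖ ^ 2 / (4 * t)) : ℂ) := by fun_prop
    exact (h4.mul (h1.mul h3)).aestronglyMeasurable
  · rw [norm_mul, norm_mul, RCLike.norm_conj, Complex.norm_real,
      Real.norm_of_nonneg (Real.exp_pos _).le]
    gcongr
    · exact norm_charFun_le v
    · exact norm_charFun_le v

/-- The discrepancy for a Gaussian kernel is a weighted `L²` distance of characteristic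
functions. -/
theorem discrepancy_gaussian (α β : Measure (Rn d)) [IsFiniteMeasure α] [IsFiniteMeasure β]
    {t : ℝ} (ht : 0 < t) :
    (4 * Real.pi * t) ^ (d / 2 : ℝ) * discrepancy (fun x => Real.exp (-t * ‖x‖ ^ 2)) α β =
      ∫ v : Rn d, Real.exp (-‖v‖ ^ 2 / (4 * t)) * ‖charFun α v - charFun β v‖ ^ 2 := by
  apply Complex.ofReal_injective
  rw [← integral_complex_ofReal]
  have e : ∀ v : Rn d, ((Real.exp (-‖v‖ ^ 2 / (4 * t)) * ‖charFun α v - charFun β v‖ ^ 2 : ℝ) : ℂ)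
      = ((Real.exp (-‖v‖ ^ 2 / (4 * t)) : ℂ) * (charFun α v * (starRingEnd ℂ) (charFun α v)) -
        (Real.exp (-‖v‖ ^ 2 / (4 * t)) : ℂ) * (charFun α v * (starRingEnd ℂ) (charFun β v))) -
        ((Real.exp (-‖v‖ ^ 2 / (4 * t)) : ℂ) * (charFun β v * (starRingEnd ℂ) (charFun α v)) -
        (Real.exp (-‖v‖ ^ 2 / (4 * t)) : ℂ) * (charFun β v * (starRingEnd ℂ) (charFun β v))) := by
    intro v
    rw [Complex.ofReal_mul, Complex.ofReal_pow, ← Complex.mul_conj', map_sub]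
    ring
  simp_rw [e]
  rw [integral_sub, integral_sub, integral_sub, ← integral_gaussian_sub ht,
    ← integral_gaussian_sub ht, ← integral_gaussian_sub ht, ← integral_gaussian_sub ht]
  · simp only [discrepancy]
    push_cast
    ring
  all_goals first
    | exact integrable_gaussian_mul_charFun ht
    | exact (integrable_gaussian_mul_charFun ht).sub (integrable_gaussian_mul_charFun ht)

theorem discrepancy_gaussian_nonneg (α β : Measure (Rn d)) [IsFiniteMeasure α] [IsFiniteMeasure β]
    {t : ℝ} (ht : 0 < t) :
    0 ≤ discrepancy (fun x => Real.exp (-t * ‖x‖ ^ 2)) α β := by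
  have h := discrepancy_gaussian α β ht
  have : 0 ≤ ∫ v : Rn d, Real.exp (-‖v‖ ^ 2 / (4 * t)) * ‖charFun α v - charFun β v‖ ^ 2 :=
    integral_nonneg fun v => by positivity
  rw [← h] at this
  exact nonneg_of_mul_nonneg_right this (by positivity)

theorem continuous_charFun (α : Measure (Rn d)) [IsFiniteMeasure α] : Continuous (charFun α) := by
  simp only [funext fun v => charFun_apply (μ := α) v]
  refine continuous_of_dominated (bound := fun _ => 1) (fun v => by fun_prop)
    (fun v => ae_of_all _ fun x => ?_) (integrable_const _) (ae_of_all _ fun x => by fun_prop)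
  rw [Complex.norm_exp_ofReal_mul_I]

/-- For times in a compact interval, the Gaussian discrepancy uniformly controls the low
frequencies. -/
theorem exists_le_discrepancy_gaussian (d : ℕ) (R : ℝ) :
    ∃ c : ℝ, 0 < c ∧ ∀ t ∈ Icc (1 : ℝ) 2, ∀ α β : Measure (Rn d), ∀ [IsFiniteMeasure α],
      ∀ [IsFiniteMeasure β],
      c * ∫ v in {v : Rn d | ‖v‖ ≤ R}, ‖charFun α v - charFun β v‖ ^ 2 ≤
        discrepancy (fun x => Real.exp (-t * ‖x‖ ^ 2)) α β := by
  refine ⟨Real.exp (-R ^ 2 / 4) / (4 * Real.pi * 2) ^ (d / 2 : ℝ), by positivity, ?_⟩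
  intro t ht α β _ _
  have ht0 : 0 < t := lt_of_lt_of_le one_pos ht.1
  have hint : Integrable (fun v : Rn d =>
      Real.exp (-‖v‖ ^ 2 / (4 * t)) * ‖charFun α v - charFun β v‖ ^ 2) := by
    refine ((integrable_exp_neg_sq_div (d := d) ht0).mul_const
      ((α.real univ + β.real univ) ^ 2)).mono' ?_ (ae_of_all _ fun v => ?_)
    · have h1 := continuous_charFun α
      have h2 := continuous_charFun β
      exact Continuous.aestronglyMeasurable (by fun_prop)
    · rw [Real.norm_of_nonneg (by positivity)]
      gcongr
      exact (norm_sub_le _ _).trans (add_le_add (norm_charFun_le v) (norm_charFun_le v))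
  have hset : MeasurableSet {v : Rn d | ‖v‖ ≤ R} := measurableSet_le (by fun_prop) (by fun_prop)
  have hcpt : IsCompact {v : Rn d | ‖v‖ ≤ R} := by
    have := isCompact_closedBall (0 : Rn d) R
    simpa [Metric.closedBall, dist_zero_right] using this
  have h1 : Real.exp (-R ^ 2 / 4) * ∫ v in {v : Rn d | ‖v‖ ≤ R}, ‖charFun α v - charFun β v‖ ^ 2 ≤
      ∫ v : Rn d, Real.exp (-‖v‖ ^ 2 / (4 * t)) * ‖charFun α v - charFun β v‖ ^ 2 := by
    rw [← integral_const_mul]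
    refine le_trans (setIntegral_mono_on ?_ hint.integrableOn hset fun v hv => ?_)
      (setIntegral_le_integral hint (ae_of_all _ fun v => by positivity))
    · have h1 := continuous_charFun α
      have h2 := continuous_charFun β
      exact ContinuousOn.integrableOn_compact hcpt (by fun_prop)
    · refine mul_le_mul_of_nonneg_right (Real.exp_le_exp.2 ?_) (by positivity)
      have hv' : ‖v‖ ^ 2 ≤ R ^ 2 := by
        have : ‖v‖ ≤ R := hv
        gcongr
      rw [neg_div, neg_div, neg_le_neg_iff]
      calc ‖v‖ ^ 2 / (4 * t) ≤ R ^ 2 / (4 * 1) := by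
            gcongr
            exact ht.1
        _ = R ^ 2 / 4 := by ring
  rw [← discrepancy_gaussian α β ht0] at h1
  have hD := discrepancy_gaussian_nonneg α β ht0
  rw [div_mul_eq_mul_div, div_le_iff₀ (by positivity), mul_comm (discrepancy _ _ _)]
  refine h1.trans ?_
  gcongr
  exact ht.2

end prod

section

/-! ### Superpositions of Gaussians -/

/-- On `S`, the function `F` is a superposition of the exponentials `s ↦ exp (-t s)`, `t > 0`, with
a nonnegative weight `w`, renormalized by affine functions of `s` so that the integral converges.
The integrand has a constant sign for each `s`, so that integrability in `s` passes from `F` to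
the superposition.  With `s = ‖x‖ ^ 2`, the affine functions do not contribute to the discrepancy of
balanced measures. -/
structure IsGaussianMixture (S : Set ℝ) (F w p q : ℝ → ℝ) : Prop where
  measurable_weight : Measurable w
  measurable_const : Measurable p
  measurable_linear : Measurable q
  weight_nonneg : ∀ t, 0 < t → 0 ≤ w t
  weight_pos : ∃ w₀, 0 < w₀ ∧ ∀ t ∈ Icc (1 : ℝ) 2, w₀ ≤ w t
  integrableOn : ∀ s ∈ S, IntegrableOn (fun t => w t * Real.exp (-t * s) + p t + q t * s) (Ioi 0)
  eq_integral : ∀ s ∈ S, F s = ∫ t in Ioi 0, w t * Real.exp (-t * s) + p t + q t * s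
  sign : ∀ s ∈ S, (∀ t, 0 < t → 0 ≤ w t * Real.exp (-t * s) + p t + q t * s) ∨
    ∀ t, 0 < t → w t * Real.exp (-t * s) + p t + q t * s ≤ 0

theorem IsGaussianMixture.norm_eq_integral {S : Set ℝ} {F w p q : ℝ → ℝ}
    (h : IsGaussianMixture S F w p q) {s : ℝ} (hs : s ∈ S) :
    ∫ t in Ioi 0, ‖w t * Real.exp (-t * s) + p t + q t * s‖ = ‖F s‖ := by
  rw [h.eq_integral s hs]
  rcases h.sign s hs with h' | h'
  · rw [Real.norm_of_nonneg (setIntegral_nonneg measurableSet_Ioi fun t ht => h' t ht)]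
    exact setIntegral_congr_fun measurableSet_Ioi fun t ht => Real.norm_of_nonneg (h' t ht)
  · rw [Real.norm_of_nonpos (setIntegral_nonpos measurableSet_Ioi fun t ht => h' t ht),
      ← integral_neg]
    exact setIntegral_congr_fun measurableSet_Ioi fun t ht => Real.norm_of_nonpos (h' t ht)

/-- Fubini for a superposition of Gaussians. -/
theorem IsGaussianMixture.integral_prod {S : Set ℝ} {F w p q : ℝ → ℝ}
    (h : IsGaussianMixture S F w p q) (μ : Measure (Rn d × Rn d)) [IsFiniteMeasure μ]
    (hS : ∀ᵐ z ∂μ, ‖z.1 - z.2‖ ^ 2 ∈ S)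
    (hF : Integrable (fun z : Rn d × Rn d => F (‖z.1 - z.2‖ ^ 2)) μ) :
    IntegrableOn (fun t => ∫ z, (w t * Real.exp (-t * ‖z.1 - z.2‖ ^ 2) + p t +
        q t * ‖z.1 - z.2‖ ^ 2) ∂μ) (Ioi 0) ∧
      ∫ z, F (‖z.1 - z.2‖ ^ 2) ∂μ =
        ∫ t in Ioi 0, ∫ z, (w t * Real.exp (-t * ‖z.1 - z.2‖ ^ 2) + p t +
          q t * ‖z.1 - z.2‖ ^ 2) ∂μ := by
  have hw := h.measurable_weight
  have hp := h.measurable_const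
  have hq := h.measurable_linear
  have hI : Integrable (fun y : (Rn d × Rn d) × ℝ =>
      w y.2 * Real.exp (-y.2 * ‖y.1.1 - y.1.2‖ ^ 2) + p y.2 + q y.2 * ‖y.1.1 - y.1.2‖ ^ 2)
      (μ.prod (volume.restrict (Ioi 0))) := by
    rw [integrable_prod_iff (Measurable.aestronglyMeasurable (by fun_prop))]
    refine ⟨?_, ?_⟩
    · filter_upwards [hS] with z hz
      exact h.integrableOn _ hz
    · refine hF.norm.congr ?_
      filter_upwards [hS] with z hz
      exact (h.norm_eq_integral hz).symm
  refine ⟨hI.integral_prod_right, ?_⟩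
  rw [← integral_integral_swap hI]
  refine integral_congr_ae ?_
  filter_upwards [hS] with z hz
  exact h.eq_integral _ hz

variable {α β : Measure (Rn d)} [IsFiniteMeasure α] [IsFiniteMeasure β]

theorem ae_add_prod_add_iff {P : Rn d × Rn d → Prop} :
    (∀ᵐ z ∂(α + β).prod (α + β), P z) ↔
      ((∀ᵐ z ∂α.prod α, P z) ∧ ∀ᵐ z ∂α.prod β, P z) ∧
        ((∀ᵐ z ∂β.prod α, P z) ∧ ∀ᵐ z ∂β.prod β, P z) := by
  rw [Measure.prod_add, Measure.add_prod, Measure.add_prod, ae_add_measure_iff,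
    ae_add_measure_iff, ae_add_measure_iff]
  tauto

/-- The discrepancy of balanced measures for a superposition of Gaussians is the superposition of
the Gaussian discrepancies. -/
theorem IsGaussianMixture.discrepancy_eq {S : Set ℝ} {F w p q : ℝ → ℝ}
    (h : IsGaussianMixture S F w p q) (hb : IsBalanced α β)
    (hS : ∀ᵐ z ∂(α + β).prod (α + β), ‖z.1 - z.2‖ ^ 2 ∈ S)
    (hF : Integrable (fun z : Rn d × Rn d => F (‖z.1 - z.2‖ ^ 2)) ((α + β).prod (α + β))) :
    IntegrableOn (fun t => w t * discrepancy (fun x => Real.exp (-t * ‖x‖ ^ 2)) α β) (Ioi 0) ∧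
      discrepancy (fun x => F (‖x‖ ^ 2)) α β =
        ∫ t in Ioi 0, w t * discrepancy (fun x => Real.exp (-t * ‖x‖ ^ 2)) α β := by
  have key : ∀ t ∈ Ioi (0 : ℝ), discrepancy (fun x : Rn d => w t * Real.exp (-t * ‖x‖ ^ 2) + p t +
      q t * ‖x‖ ^ 2) α β = w t * discrepancy (fun x => Real.exp (-t * ‖x‖ ^ 2)) α β := by
    intro t ht
    have ht0 : 0 ≤ t := le_of_lt ht
    have i1 : Integrable (fun z : Rn d × Rn d => w t * Real.exp (-t * ‖z.1 - z.2‖ ^ 2))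
        ((α + β).prod (α + β)) := (integrable_gaussian_sub ht0).const_mul _
    have i2 : Integrable (fun z : Rn d × Rn d => p t) ((α + β).prod (α + β)) :=
      integrable_const _
    have i3 : Integrable (fun z : Rn d × Rn d => q t * ‖z.1 - z.2‖ ^ 2) ((α + β).prod (α + β)) :=
      hb.integrable_norm_sq_sub.const_mul _
    rw [discrepancy_add (k := fun x => w t * Real.exp (-t * ‖x‖ ^ 2) + p t)
        (l := fun x => q t * ‖x‖ ^ 2) (i1.add i2) i3,
      discrepancy_add (k := fun x => w t * Real.exp (-t * ‖x‖ ^ 2)) (l := fun _ => p t) i1 i2,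
      discrepancy_const_mul, discrepancy_const_mul, discrepancy_const hb.mass_eq,
      hb.discrepancy_norm_sq]
    ring
  rw [ae_add_prod_add_iff] at hS
  rw [integrable_add_prod_add_iff] at hF
  obtain ⟨⟨s1, s2⟩, s3, s4⟩ := hS
  obtain ⟨⟨f1, f2⟩, f3, f4⟩ := hF
  obtain ⟨a1, b1⟩ := h.integral_prod _ s1 f1
  obtain ⟨a2, b2⟩ := h.integral_prod _ s2 f2
  obtain ⟨a3, b3⟩ := h.integral_prod _ s3 f3
  obtain ⟨a4, b4⟩ := h.integral_prod _ s4 f4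
  constructor
  · exact IntegrableOn.congr_fun ((a1.sub a2).sub (a3.sub a4)) (fun t ht => key t ht)
      measurableSet_Ioi
  · rw [discrepancy, b1, b2, b3, b4, ← integral_sub a1 a2, ← integral_sub a3 a4,
      ← integral_sub (by exact a1.sub a2) (by exact a3.sub a4)]
    exact setIntegral_congr_fun measurableSet_Ioi key

theorem IsGaussianMixture.discrepancy_nonneg {S : Set ℝ} {F w p q : ℝ → ℝ}
    (h : IsGaussianMixture S F w p q) (hb : IsBalanced α β)
    (hS : ∀ᵐ z ∂(α + β).prod (α + β), ‖z.1 - z.2‖ ^ 2 ∈ S)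
    (hF : Integrable (fun z : Rn d × Rn d => F (‖z.1 - z.2‖ ^ 2)) ((α + β).prod (α + β))) :
    0 ≤ discrepancy (fun x => F (‖x‖ ^ 2)) α β := by
  rw [(h.discrepancy_eq hb hS hF).2]
  exact setIntegral_nonneg measurableSet_Ioi fun t ht =>
    mul_nonneg (h.weight_nonneg t ht) (discrepancy_gaussian_nonneg α β ht)

theorem IsGaussianMixture.exists_le_discrepancy {S : Set ℝ} {F w p q : ℝ → ℝ}
    (h : IsGaussianMixture S F w p q) (d : ℕ) (R : ℝ) :
    ∃ c : ℝ, 0 < c ∧ ∀ α β : Measure (Rn d), ∀ [IsFiniteMeasure α], ∀ [IsFiniteMeasure β],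
      IsBalanced α β → (∀ᵐ z ∂(α + β).prod (α + β), ‖z.1 - z.2‖ ^ 2 ∈ S) →
      Integrable (fun z : Rn d × Rn d => F (‖z.1 - z.2‖ ^ 2)) ((α + β).prod (α + β)) →
      c * ∫ v in {v : Rn d | ‖v‖ ≤ R}, ‖charFun α v - charFun β v‖ ^ 2 ≤
        discrepancy (fun x => F (‖x‖ ^ 2)) α β := by
  obtain ⟨c, hc, H⟩ := exists_le_discrepancy_gaussian d R
  obtain ⟨w₀, hw₀, hw⟩ := h.weight_pos
  refine ⟨w₀ * c, by positivity, ?_⟩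
  intro α β _ _ hb hS hF
  obtain ⟨h1, h2⟩ := h.discrepancy_eq hb hS hF
  rw [h2]
  set I := ∫ v in {v : Rn d | ‖v‖ ≤ R}, ‖charFun α v - charFun β v‖ ^ 2 with hI
  have hI0 : 0 ≤ I := integral_nonneg fun v => by positivity
  have hsub : Icc (1 : ℝ) 2 ⊆ Ioi 0 := fun t ht => lt_of_lt_of_le one_pos ht.1
  calc w₀ * c * I = ∫ _ in Icc (1 : ℝ) 2, w₀ * c * I := by
        rw [setIntegral_const, Real.volume_real_Icc]
        norm_num
    _ ≤ ∫ t in Icc (1 : ℝ) 2, w t * discrepancy (fun x => Real.exp (-t * ‖x‖ ^ 2)) α β := by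
        refine setIntegral_mono_on (integrable_const _) (h1.mono_set hsub) measurableSet_Icc
          fun t ht => ?_
        rw [mul_assoc]
        exact mul_le_mul (hw t ht) (H t ht α β) (by positivity) (h.weight_nonneg t (hsub ht))
    _ ≤ _ := by
        refine setIntegral_mono_set h1 ?_ (hsub.eventuallyLE)
        filter_upwards [ae_restrict_mem measurableSet_Ioi] with t ht
        exact mul_nonneg (h.weight_nonneg t ht) (discrepancy_gaussian_nonneg α β ht)

end

section

/-! ### Powers and the logarithm as superpositions of Gaussians -/

theorem IsGaussianMixture.const_mul {S : Set ℝ} {F w p q : ℝ → ℝ}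
    (h : IsGaussianMixture S F w p q) {c : ℝ} (hc : 0 < c) :
    IsGaussianMixture S (fun s => c * F s) (fun t => c * w t) (fun t => c * p t)
      (fun t => c * q t) := by
  have e : ∀ s t : ℝ, c * w t * Real.exp (-t * s) + c * p t + c * q t * s =
      c * (w t * Real.exp (-t * s) + p t + q t * s) := fun s t => by ring
  refine ⟨h.measurable_weight.const_mul c, h.measurable_const.const_mul c,
    h.measurable_linear.const_mul c, fun t ht => mul_nonneg hc.le (h.weight_nonneg t ht), ?_,
    ?_, ?_, ?_⟩
  · obtain ⟨w₀, h0, h1⟩ := h.weight_pos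
    exact ⟨c * w₀, by positivity, fun t ht => by gcongr; exact h1 t ht⟩
  · intro s hs
    simp_rw [e]
    exact (h.integrableOn s hs).const_mul c
  · intro s hs
    simp_rw [e]
    rw [integral_const_mul, h.eq_integral s hs]
  · intro s hs
    simp_rw [e]
    rcases h.sign s hs with h' | h'
    · exact Or.inl fun t ht => mul_nonneg hc.le (h' t ht)
    · exact Or.inr fun t ht => mul_nonpos_of_nonneg_of_nonpos hc.le (h' t ht)

theorem IsGaussianMixture.comp_add {S T : Set ℝ} {F w p q : ℝ → ℝ}
    (h : IsGaussianMixture S F w p q) {δ : ℝ} (hT : ∀ s ∈ T, s + δ ∈ S) :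
    IsGaussianMixture T (fun s => F (s + δ)) (fun t => w t * Real.exp (-t * δ))
      (fun t => p t + q t * δ) q := by
  have e : ∀ s t : ℝ, w t * Real.exp (-t * δ) * Real.exp (-t * s) + (p t + q t * δ) + q t * s =
      w t * Real.exp (-t * (s + δ)) + p t + q t * (s + δ) := fun s t => by
    rw [mul_assoc, ← Real.exp_add]
    ring_nf
  have hw := h.measurable_weight
  have hp := h.measurable_const
  have hq := h.measurable_linear
  refine ⟨by fun_prop, by fun_prop, hq,
    fun t ht => mul_nonneg (h.weight_nonneg t ht) (Real.exp_pos _).le, ?_, ?_, ?_, ?_⟩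
  · obtain ⟨w₀, h0, h1⟩ := h.weight_pos
    refine ⟨w₀ * Real.exp (-2 * |δ|), by positivity, fun t ht => ?_⟩
    refine mul_le_mul (h1 t ht) (Real.exp_le_exp.2 ?_) (Real.exp_pos _).le
      (h.weight_nonneg t (lt_of_lt_of_le one_pos ht.1))
    have := ht.1
    have := ht.2
    nlinarith [abs_nonneg δ, le_abs_self δ]
  · intro s hs
    simp_rw [e]
    exact h.integrableOn _ (hT s hs)
  · intro s hs
    simp_rw [e]
    exact h.eq_integral _ (hT s hs)
  · intro s hs
    simp_rw [e]
    exact h.sign _ (hT s hs)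

theorem integrableOn_Ioi_of_norm_le_rpow {f : ℝ → ℝ} (hf : Measurable f) {C r₀ r₁ : ℝ}
    (hr₀ : -1 < r₀) (hr₁ : r₁ < -1) (h₀ : ∀ u, 0 < u → u ≤ 1 → ‖f u‖ ≤ C * u ^ r₀)
    (h₁ : ∀ u, 1 < u → ‖f u‖ ≤ C * u ^ r₁) : IntegrableOn f (Ioi 0) := by
  rw [← Ioc_union_Ioi_eq_Ioi zero_le_one]
  refine IntegrableOn.union ?_ ?_
  · have i : IntegrableOn (fun u : ℝ => C * u ^ r₀) (Ioc 0 1) := by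
      have := (intervalIntegral.intervalIntegrable_rpow' (a := 0) (b := 1) hr₀).const_mul C
      rwa [intervalIntegrable_iff_integrableOn_Ioc_of_le zero_le_one] at this
    refine i.mono' hf.aestronglyMeasurable ?_
    filter_upwards [ae_restrict_mem measurableSet_Ioc] with u hu
    exact h₀ u hu.1 hu.2
  · have i : IntegrableOn (fun u : ℝ => C * u ^ r₁) (Ioi 1) :=
      (integrableOn_Ioi_rpow_of_lt hr₁ one_pos).const_mul C
    refine i.mono' hf.aestronglyMeasurable ?_
    filter_upwards [ae_restrict_mem measurableSet_Ioi] with u hu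
    exact h₁ u hu

/-- By scaling, if `ψ u = exp (-u) + c₀ + c₁ u` has a strict sign for `u > 0` and
`K = ∫ u ^ (-p - 1) ψ u du` converges, then `K s ^ p` is a superposition of Gaussians. -/
theorem isGaussianMixture_rpow {p c₀ c₁ σ : ℝ} (hσ : σ = 1 ∨ σ = -1)
    (hsign : ∀ u, 0 < u → 0 < σ * (Real.exp (-u) + c₀ + c₁ * u))
    (hint : IntegrableOn (fun u : ℝ => u ^ (-p - 1) * (Real.exp (-u) + c₀ + c₁ * u)) (Ioi 0))
    {S : Set ℝ} (hS : ∀ s ∈ S, 0 < s ∨ (s = 0 ∧ p ≠ 0 ∧ c₀ = -1)) :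
    ∃ K : ℝ, 0 < σ * K ∧ IsGaussianMixture S (fun s => K * s ^ p) (fun t => t ^ (-p - 1))
      (fun t => t ^ (-p - 1) * c₀) (fun t => t ^ (-p - 1) * (c₁ * t)) := by
  set g : ℝ → ℝ := fun u => u ^ (-p - 1) * (Real.exp (-u) + c₀ + c₁ * u) with hg
  have e : ∀ s t : ℝ, t ^ (-p - 1) * Real.exp (-t * s) + t ^ (-p - 1) * c₀ +
      t ^ (-p - 1) * (c₁ * t) * s = t ^ (-p - 1) * (Real.exp (-(t * s)) + c₀ + c₁ * (t * s)) :=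
    fun s t => by rw [neg_mul]; ring
  have e' : ∀ s, 0 < s → ∀ t ∈ Ioi (0 : ℝ), t ^ (-p - 1) * (Real.exp (-(t * s)) + c₀ +
      c₁ * (t * s)) = s ^ (p + 1) * g (t * s) := by
    intro s hs t ht
    have ht0 : (0 : ℝ) < t := ht
    simp only [hg]
    rw [Real.mul_rpow ht0.le hs.le]
    have : s ^ (p + 1) * s ^ (-p - 1) = 1 := by
      rw [← Real.rpow_add hs]
      ring_nf
      exact Real.rpow_zero s
    linear_combination (-(t ^ (-p - 1) * (Real.exp (-(t * s)) + c₀ + c₁ * (t * s)))) * this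
  have e0 : ∀ s ∈ S, s = 0 → ∀ t : ℝ, t ^ (-p - 1) * (Real.exp (-(t * s)) + c₀ +
      c₁ * (t * s)) = 0 := by
    intro s hs h0 t
    rcases hS s hs with h | ⟨_, _, hc⟩
    · exact absurd h0 h.ne'
    · rw [h0, hc]
      simp
  refine ⟨∫ u in Ioi 0, g u, ?_, by fun_prop, by fun_prop, by fun_prop,
    fun t ht => Real.rpow_nonneg ht.le _, ?_, ?_, ?_, ?_⟩
  · rw [← integral_const_mul, setIntegral_pos_iff_support_of_nonneg_ae]
    · have : Function.support (fun u => σ * g u) ∩ Ioi 0 = Ioi 0 := by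
        refine inter_eq_right.2 fun u hu => ?_
        have h1 : 0 < u ^ (-p - 1) := Real.rpow_pos_of_pos hu _
        have := mul_pos h1 (hsign u hu)
        have h2 : σ * g u = u ^ (-p - 1) * (σ * (Real.exp (-u) + c₀ + c₁ * u)) := by
          simp only [hg]; ring
        rw [Function.mem_support, h2]
        exact this.ne'
      rw [this]
      simp
    · filter_upwards [ae_restrict_mem measurableSet_Ioi] with u hu
      have h1 : 0 < u ^ (-p - 1) := Real.rpow_pos_of_pos hu _
      have h2 : σ * g u = u ^ (-p - 1) * (σ * (Real.exp (-u) + c₀ + c₁ * u)) := by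
        simp only [hg]; ring
      rw [h2]
      exact (mul_pos h1 (hsign u hu)).le
    · exact hint.const_mul σ
  · have hc : ContinuousOn (fun t : ℝ => t ^ (-p - 1)) (Icc 1 2) := fun t ht =>
      (Real.continuousAt_rpow_const t _
        (Or.inl (lt_of_lt_of_le one_pos ht.1).ne')).continuousWithinAt
    obtain ⟨t₀, ht₀, hmin⟩ := isCompact_Icc.exists_isMinOn (by simp) hc
    exact ⟨_, Real.rpow_pos_of_pos (lt_of_lt_of_le one_pos ht₀.1) _, fun t ht => hmin ht⟩
  · intro s hs
    simp_rw [e]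
    rcases hS s hs with h | h
    · refine IntegrableOn.congr_fun ?_ (fun t ht => (e' s h t ht).symm) measurableSet_Ioi
      refine Integrable.const_mul ?_ _
      have := (integrableOn_Ioi_comp_mul_right_iff g 0 h).2 (by rwa [zero_mul])
      exact this
    · simp_rw [e0 s hs h.1]
      exact integrableOn_zero
  · intro s hs
    simp_rw [e]
    rcases hS s hs with h | h
    · rw [setIntegral_congr_fun measurableSet_Ioi (e' s h), integral_const_mul,
        integral_comp_mul_right_Ioi g 0 h, zero_mul, Real.rpow_add h, Real.rpow_one, smul_eq_mul]
      have := h.ne'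
      field_simp
    · simp_rw [e0 s hs h.1]
      rw [h.1, Real.zero_rpow h.2.1]
      simp
  · intro s hs
    simp_rw [e]
    rcases hS s hs with h | h
    · rcases hσ with rfl | rfl
      · left
        intro t ht
        refine mul_nonneg (Real.rpow_nonneg ht.le _) ?_
        have := hsign (t * s) (by positivity)
        linarith
      · right
        intro t ht
        refine mul_nonpos_of_nonneg_of_nonpos (Real.rpow_nonneg ht.le _) ?_
        have := hsign (t * s) (by positivity)
        linarith
    · left
      intro t _
      rw [e0 s hs h.1]

theorem exp_neg_le_quadratic {u : ℝ} (hu : 0 ≤ u) : Real.exp (-u) ≤ 1 - u + u ^ 2 / 2 := by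
  have h := Real.quadratic_le_exp_of_nonneg hu
  have h1 : Real.exp (-u) * Real.exp u = 1 := by rw [← Real.exp_add]; simp
  have h2 := Real.exp_pos (-u)
  have h3 : Real.exp (-u) * (1 + u + u ^ 2 / 2) ≤ 1 := by
    calc _ ≤ Real.exp (-u) * Real.exp u := by gcongr
      _ = 1 := h1
  by_contra hc
  push Not at hc
  have h4 : 0 < 1 + u + u ^ 2 / 2 := by positivity
  nlinarith [mul_lt_mul_of_pos_right hc h4, sq_nonneg (u ^ 2)]

/-- `s ^ p` with `1 < p < 2`: the exponential is renormalized by its first order expansion. -/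
theorem exists_isGaussianMixture_rpow_one_two {p : ℝ} (h1 : 1 < p) (h2 : p < 2) :
    ∃ w f q, IsGaussianMixture (Ici 0) (fun s => s ^ p) w f q := by
  obtain ⟨K, hK, h⟩ := isGaussianMixture_rpow (p := p) (c₀ := -1) (c₁ := 1) (σ := 1)
    (S := Ici 0) (Or.inl rfl)
    (fun u hu => by
      have := Real.add_one_lt_exp (neg_ne_zero.2 hu.ne')
      linarith)
    (by
      refine integrableOn_Ioi_of_norm_le_rpow (C := 1) (r₀ := 1 - p) (r₁ := -p) (by fun_prop)
        (by linarith) (by linarith) (fun u hu _ => ?_) (fun u hu => ?_)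
      · have a1 := exp_neg_le_quadratic hu.le
        have a2 := Real.add_one_le_exp (-u)
        have a3 : u ^ (1 - p) = u ^ (-p - 1) * u ^ 2 := by
          rw [← Real.rpow_natCast, ← Real.rpow_add hu]
          norm_num
          ring_nf
        have a4 := Real.rpow_pos_of_pos hu (-p - 1)
        rw [norm_mul, Real.norm_of_nonneg a4.le, Real.norm_of_nonneg (by linarith), one_mul,
          one_mul, a3]
        gcongr
        nlinarith
      · have hu0 : 0 < u := one_pos.trans hu
        have a2 := Real.add_one_le_exp (-u)
        have a1 : Real.exp (-u) ≤ 1 := Real.exp_le_one_iff.2 (by linarith)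
        have a3 : u ^ (-p) = u ^ (-p - 1) * u := by
          nth_rw 3 [← Real.rpow_one u]
          rw [← Real.rpow_add hu0]
          norm_num
        have a4 := Real.rpow_pos_of_pos hu0 (-p - 1)
        rw [norm_mul, Real.norm_of_nonneg a4.le, Real.norm_of_nonneg (by linarith), one_mul,
          one_mul, a3]
        gcongr
        linarith)
    (fun s hs => by
      rcases eq_or_lt_of_le (mem_Ici.1 hs) with h | h
      · exact Or.inr ⟨h.symm, by linarith, rfl⟩
      · exact Or.inl h)
  rw [one_mul] at hK
  have := h.const_mul (inv_pos.2 hK)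
  simp_rw [← mul_assoc, inv_mul_cancel₀ hK.ne', one_mul] at this
  exact ⟨_, _, _, this⟩

/-- `-s ^ p` with `0 < p < 1`: the exponential is renormalized by the constant `1`. -/
theorem exists_isGaussianMixture_neg_rpow {p : ℝ} (h0 : 0 < p) (h1 : p < 1) :
    ∃ w f q, IsGaussianMixture (Ici 0) (fun s => -s ^ p) w f q := by
  obtain ⟨K, hK, h⟩ := isGaussianMixture_rpow (p := p) (c₀ := -1) (c₁ := 0) (σ := -1)
    (S := Ici 0) (Or.inr rfl)
    (fun u hu => by
      have : Real.exp (-u) < 1 := Real.exp_lt_one_iff.2 (by linarith)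
      linarith)
    (by
      refine integrableOn_Ioi_of_norm_le_rpow (C := 1) (r₀ := -p) (r₁ := -p - 1) (by fun_prop)
        (by linarith) (by linarith) (fun u hu _ => ?_) (fun u hu => ?_)
      · have a1 : Real.exp (-u) ≤ 1 := Real.exp_le_one_iff.2 (by linarith)
        have a2 := Real.add_one_le_exp (-u)
        have a3 : u ^ (-p) = u ^ (-p - 1) * u := by
          nth_rw 3 [← Real.rpow_one u]
          rw [← Real.rpow_add hu]
          norm_num
        have a4 := Real.rpow_pos_of_pos hu (-p - 1)
        rw [norm_mul, Real.norm_of_nonneg a4.le, Real.norm_of_nonpos (by linarith), one_mul, a3]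
        gcongr
        linarith
      · have hu0 : 0 < u := one_pos.trans hu
        have a1 : Real.exp (-u) ≤ 1 := Real.exp_le_one_iff.2 (by linarith)
        have a4 := Real.rpow_pos_of_pos hu0 (-p - 1)
        have a5 := Real.exp_pos (-u)
        rw [norm_mul, Real.norm_of_nonneg a4.le, Real.norm_of_nonpos (by linarith), one_mul]
        exact mul_le_of_le_one_right a4.le (by linarith))
    (fun s hs => by
      rcases eq_or_lt_of_le (mem_Ici.1 hs) with h | h
      · exact Or.inr ⟨h.symm, by linarith, rfl⟩
      · exact Or.inl h)
  have hK' : 0 < -K := by linarith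
  have := h.const_mul (inv_pos.2 hK')
  have e : ∀ s : ℝ, (-K)⁻¹ * (K * s ^ p) = -s ^ p := fun s => by
    have : K ≠ 0 := by linarith
    field_simp
  simp_rw [e] at this
  exact ⟨_, _, _, this⟩

/-- `s ^ p` with `p < 0` needs no renormalization. -/
theorem exists_isGaussianMixture_rpow_of_neg {p : ℝ} (hp : p < 0) :
    ∃ w f q, IsGaussianMixture (Ioi 0) (fun s => s ^ p) w f q := by
  obtain ⟨K, hK, h⟩ := isGaussianMixture_rpow (p := p) (c₀ := 0) (c₁ := 0) (σ := 1)
    (S := Ioi 0) (Or.inl rfl)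
    (fun u hu => by
      have := Real.exp_pos (-u)
      linarith)
    (by
      refine (Real.GammaIntegral_convergent (neg_pos.2 hp)).congr_fun (fun u _ => ?_)
        measurableSet_Ioi
      simp only
      ring)
    (fun s hs => Or.inl hs)
  rw [one_mul] at hK
  have := h.const_mul (inv_pos.2 hK)
  simp_rw [← mul_assoc, inv_mul_cancel₀ hK.ne', one_mul] at this
  exact ⟨_, _, _, this⟩

theorem integrableOn_frullani_exp {s : ℝ} (hs : 0 < s) :
    IntegrableOn (fun t : ℝ => t⁻¹ * (Real.exp (-(s * t)) - Real.exp (-t))) (Ioi 0) := by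
  have i1 : IntegrableOn (fun t : ℝ => Real.exp (-s * t)) (Ioi 0) :=
    integrableOn_exp_mul_Ioi (by linarith) 0
  have i2 : IntegrableOn (fun t : ℝ => Real.exp (-1 * t)) (Ioi 0) :=
    integrableOn_exp_mul_Ioi (by linarith) 0
  refine ((i1.add i2).const_mul |s - 1|).mono' (by fun_prop) ?_
  filter_upwards [ae_restrict_mem measurableSet_Ioi] with t ht
  have ht0 : (0 : ℝ) < t := ht
  -- convexity: `exp (-u) - exp (-v) ≤ (v - u) exp (-u)`
  have key : ∀ u v : ℝ, Real.exp (-u) - Real.exp (-v) ≤ (v - u) * Real.exp (-u) := by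
    intro u v
    have h1 := Real.add_one_le_exp (u - v)
    have h2 : Real.exp (-v) = Real.exp (u - v) * Real.exp (-u) := by
      rw [← Real.exp_add]
      ring_nf
    rw [h2]
    nlinarith [Real.exp_pos (-u)]
  have k1 := key (s * t) t
  have k2 := key t (s * t)
  have b1 : (t - s * t) ≤ |s - 1| * t := by nlinarith [neg_abs_le (s - 1)]
  have b2 : (s * t - t) ≤ |s - 1| * t := by nlinarith [le_abs_self (s - 1)]
  have p1 := Real.exp_pos (-(s * t))
  have p2 := Real.exp_pos (-t)
  have h0 : 0 ≤ |s - 1| * t := by positivity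
  simp only [Pi.add_apply, neg_mul, one_mul]
  rw [norm_mul, norm_inv, Real.norm_of_nonneg ht0.le, inv_mul_le_iff₀ ht0, Real.norm_eq_abs,
    abs_le]
  constructor
  · nlinarith [mul_le_mul_of_nonneg_right b2 p2.le, mul_nonneg h0 p1.le]
  · nlinarith [mul_le_mul_of_nonneg_right b1 p1.le, mul_nonneg h0 p2.le]

/-- Frullani's integral represents `-log s`. -/
theorem exists_isGaussianMixture_neg_log :
    ∃ w f q, IsGaussianMixture (Ioi 0) (fun s => -Real.log s) w f q := by
  have e : ∀ s t : ℝ, t⁻¹ * Real.exp (-t * s) + -(t⁻¹ * Real.exp (-t)) + 0 * s =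
      t⁻¹ * (Real.exp (-(s * t)) - Real.exp (-t)) := fun s t => by
    rw [neg_mul, mul_comm t s]
    ring
  refine ⟨fun t => t⁻¹, fun t => -(t⁻¹ * Real.exp (-t)), fun _ => 0, by fun_prop, by fun_prop,
    by fun_prop, fun t ht => (inv_pos.2 ht).le, ⟨2⁻¹, by norm_num, fun t ht => ?_⟩, ?_, ?_, ?_⟩
  · exact inv_anti₀ (lt_of_lt_of_le one_pos ht.1) ht.2
  · intro s hs
    simp_rw [e]
    exact integrableOn_frullani_exp hs
  · intro s hs
    simp_rw [e]
    have hc : Continuous fun x : ℝ => Real.exp (-x) := by fun_prop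
    have h := Frullani.integral_Ioi_eq (f := fun x : ℝ => Real.exp (-x)) (a := s) (b := 1)
      (L := 1) (R := 0) (hc.continuousOn.locallyIntegrableOn measurableSet_Ioi) hs one_pos
      (by
        have := hc.tendsto 0
        simp only [neg_zero, Real.exp_zero] at this
        exact this.mono_left nhdsWithin_le_nhds)
      Real.tendsto_exp_neg_atTop_nhds_zero
      (by simpa only [smul_eq_mul, one_mul] using integrableOn_frullani_exp hs)
    simp only [smul_eq_mul, one_mul, sub_zero, mul_one, one_div, Real.log_inv] at h
    exact h.symm
  · intro s hs
    simp_rw [e]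
    rcases le_total s 1 with h | h
    · left
      intro t ht
      refine mul_nonneg (inv_pos.2 ht).le (sub_nonneg.2 (Real.exp_le_exp.2 ?_))
      nlinarith
    · right
      intro t ht
      refine mul_nonpos_of_nonneg_of_nonpos (inv_pos.2 ht).le
        (sub_nonpos.2 (Real.exp_le_exp.2 ?_))
      nlinarith

/-- The repulsive part of the potential, as a function of `s = ‖x‖ ^ 2`. -/
theorem exists_isGaussianMixture_neg_powerTerm {b : ℝ} (hb : b < 2) :
    ∃ w f q, IsGaussianMixture {s | 0 ≤ s ∧ (b ≤ 0 → 0 < s)}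
      (fun s => -powerTerm b (√s)) w f q := by
  have mono : ∀ {S T : Set ℝ} {F G w f q : ℝ → ℝ}, IsGaussianMixture S F w f q → T ⊆ S →
      (∀ s ∈ T, G s = F s) → IsGaussianMixture T G w f q := by
    intro S T F G w f q h hT hG
    exact ⟨h.1, h.2, h.3, h.4, h.5, fun s hs => h.6 s (hT hs),
      fun s hs => (hG s hs).trans (h.7 s (hT hs)), fun s hs => h.8 s (hT hs)⟩
  have sqrt_rpow : ∀ s : ℝ, 0 ≤ s → √s ^ b = s ^ (b / 2) := fun s hs => by
    rw [Real.sqrt_eq_rpow, ← Real.rpow_mul hs]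
    ring_nf
  rcases lt_trichotomy b 0 with h | h | h
  · obtain ⟨w, f, q, H⟩ := exists_isGaussianMixture_rpow_of_neg (p := b / 2) (by linarith)
    refine ⟨_, _, _, mono (H.const_mul (c := -b⁻¹) (by have := inv_lt_zero.2 h; linarith))
      (fun s hs => hs.2 h.le) fun s hs => ?_⟩
    rw [powerTerm, if_neg h.ne, sqrt_rpow s hs.1]
    ring
  · obtain ⟨w, f, q, H⟩ := exists_isGaussianMixture_neg_log
    refine ⟨_, _, _, mono (H.const_mul (c := 1 / 2) (by norm_num))
      (fun s hs => hs.2 h.le) fun s hs => ?_⟩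
    rw [powerTerm, if_pos h, Real.log_sqrt hs.1]
    ring
  · obtain ⟨w, f, q, H⟩ := exists_isGaussianMixture_neg_rpow (p := b / 2) (by linarith)
      (by linarith)
    refine ⟨_, _, _, mono (H.const_mul (c := b⁻¹) (inv_pos.2 h))
      (fun s hs => hs.1) fun s hs => ?_⟩
    rw [powerTerm, if_neg h.ne', sqrt_rpow s hs.1]
    ring

variable {α β : Measure (Rn d)} [IsFiniteMeasure α] [IsFiniteMeasure β]

/-- The attractive part of the potential contributes nonnegatively. -/
theorem IsBalanced.discrepancy_norm_rpow_nonneg (h : IsBalanced α β) {a : ℝ} (ha2 : 2 ≤ a)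
    (ha4 : a ≤ 4)
    (hint : Integrable (fun z : Rn d × Rn d => ‖z.1 - z.2‖ ^ a) ((α + β).prod (α + β))) :
    0 ≤ discrepancy (fun x => ‖x‖ ^ a) α β := by
  have main : ∀ c : ℝ, 2 < c → c < 4 →
      Integrable (fun z : Rn d × Rn d => ‖z.1 - z.2‖ ^ c) ((α + β).prod (α + β)) →
      0 ≤ discrepancy (fun x => ‖x‖ ^ c) α β := by
    intro c h2 h4 hc
    obtain ⟨w, f, q, H⟩ := exists_isGaussianMixture_rpow_one_two (p := c / 2) (by linarith)
      (by linarith)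
    have e : ∀ x : Rn d, (‖x‖ ^ 2) ^ (c / 2) = ‖x‖ ^ c := fun x => by
      rw [← Real.rpow_natCast, ← Real.rpow_mul (norm_nonneg x)]
      congr 1
      push_cast
      ring
    have := H.discrepancy_nonneg h (ae_of_all _ fun z => sq_nonneg ‖z.1 - z.2‖)
      (by simpa only [e] using hc)
    simpa only [e] using this
  rcases eq_or_lt_of_le ha2 with rfl | ha2
  · have := h.discrepancy_norm_sq
    simp_rw [← Real.rpow_natCast] at this
    exact this.ge
  rcases lt_or_eq_of_le ha4 with ha4 | rfl
  · exact main a ha2 ha4 hint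
  -- The exponent `4` is the limit of smaller exponents.
  set e : ℕ → ℝ := fun n => 4 - 1 / ((n : ℝ) + 1) with he
  have he4 : ∀ n, e n < 4 := fun n => by
    have : (0 : ℝ) < 1 / ((n : ℝ) + 1) := by positivity
    simp only [he]
    linarith
  have he2 : ∀ n, 2 < e n := fun n => by
    have : 1 / ((n : ℝ) + 1) ≤ 1 := by
      rw [div_le_one (by positivity)]
      have : (0 : ℝ) ≤ n := by positivity
      linarith
    simp only [he]
    linarith
  have hlim : Tendsto e atTop (𝓝 4) := by
    have := (tendsto_one_div_add_atTop_nhds_zero_nat (𝕜 := ℝ)).const_sub 4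
    rwa [sub_zero] at this
  have bound : ∀ n (z : Rn d × Rn d), ‖‖z.1 - z.2‖ ^ e n‖ ≤ 1 + ‖z.1 - z.2‖ ^ (4 : ℝ) := by
    intro n z
    rw [Real.norm_of_nonneg (Real.rpow_nonneg (norm_nonneg _) _)]
    rcases le_total ‖z.1 - z.2‖ 1 with h1 | h1
    · have := Real.rpow_le_one (norm_nonneg _) h1 (by linarith [he2 n] : 0 ≤ e n)
      have := Real.rpow_nonneg (norm_nonneg (z.1 - z.2)) 4
      linarith
    · have := Real.rpow_le_rpow_of_exponent_le h1 (he4 n).le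
      linarith
  have ibound : Integrable (fun z : Rn d × Rn d => 1 + ‖z.1 - z.2‖ ^ (4 : ℝ))
      ((α + β).prod (α + β)) := (integrable_const _).add hint
  have hn : ∀ n, 0 ≤ discrepancy (fun x => ‖x‖ ^ e n) α β := fun n =>
    main _ (he2 n) (he4 n) (ibound.mono' (Measurable.aestronglyMeasurable (by fun_prop))
      (ae_of_all _ (bound n)))
  rw [integrable_add_prod_add_iff] at ibound
  obtain ⟨⟨i1, i2⟩, i3, i4⟩ := ibound
  have hptw : ∀ z : Rn d × Rn d, Tendsto (fun n => ‖z.1 - z.2‖ ^ e n) atTop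
      (𝓝 (‖z.1 - z.2‖ ^ (4 : ℝ))) := fun z =>
    tendsto_const_nhds.rpow hlim (Or.inr (by norm_num))
  have lim : ∀ μ : Measure (Rn d × Rn d), Integrable (fun z => 1 + ‖z.1 - z.2‖ ^ (4 : ℝ)) μ →
      Tendsto (fun n => ∫ z, ‖z.1 - z.2‖ ^ e n ∂μ) atTop (𝓝 (∫ z, ‖z.1 - z.2‖ ^ (4 : ℝ) ∂μ)) :=
    fun μ hμ => tendsto_integral_of_dominated_convergence _
      (fun n => Measurable.aestronglyMeasurable (by fun_prop)) hμ
      (fun n => ae_of_all _ (bound n)) (ae_of_all _ hptw)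
  exact ge_of_tendsto (((lim _ i1).sub (lim _ i2)).sub ((lim _ i3).sub (lim _ i4)))
    (Eventually.of_forall hn)

end

/-! ### The regularized potential -/

/-- The potential with the repulsive part regularized at the origin, `|x|` being replaced by
`√(|x| ^ 2 + δ)` there.  For `δ = 0` it is the real part of the potential. -/
def regPotential (a b δ : ℝ) (x : Rn d) : ℝ :=
  powerTerm a ‖x‖ - powerTerm b (√(‖x‖ ^ 2 + δ))

theorem powerTerm_mono (b : ℝ) {r r' : ℝ} (hr : 0 < r) (h : r ≤ r') :
    powerTerm b r ≤ powerTerm b r' := by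
  unfold powerTerm
  split_ifs with hb
  · exact Real.log_le_log hr h
  · rcases lt_or_gt_of_ne hb with hb | hb
    · have h1 := Real.rpow_le_rpow_of_nonpos hr h hb.le
      exact div_le_div_of_nonpos_of_le hb.le h1
    · have := Real.rpow_le_rpow hr.le h hb.le
      gcongr

theorem powerTerm_zero (b : ℝ) : powerTerm b 0 = 0 := by
  unfold powerTerm
  split_ifs with hb
  · simp
  · simp [Real.zero_rpow hb]

theorem powerTerm_of_pos {a : ℝ} (ha : 0 < a) (r : ℝ) : powerTerm a r = r ^ a / a :=
  if_neg ha.ne'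

@[fun_prop]
theorem measurable_powerTerm (b : ℝ) : Measurable (powerTerm b) := by
  unfold powerTerm
  split_ifs <;> fun_prop

@[fun_prop]
theorem measurable_regPotential (a b δ : ℝ) : Measurable (regPotential (d := d) a b δ) := by
  unfold regPotential
  fun_prop

theorem continuousAt_powerTerm (b : ℝ) {r : ℝ} (hr : 0 < r) : ContinuousAt (powerTerm b) r := by
  unfold powerTerm
  split_ifs
  · exact Real.continuousAt_log hr.ne'
  · exact (Real.continuousAt_rpow_const r b (Or.inl hr.ne')).div_const b

theorem continuous_powerTerm_of_pos {a : ℝ} (ha : 0 < a) : Continuous (powerTerm a) := by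
  have : powerTerm a = fun r => r ^ a / a := funext (powerTerm_of_pos ha)
  rw [this]
  exact (Real.continuous_rpow_const ha.le).div_const a

theorem continuous_regPotential {a : ℝ} (ha : 0 < a) (b : ℝ) {δ : ℝ} (hδ : 0 < δ) :
    Continuous (regPotential (d := d) a b δ) := by
  refine ((continuous_powerTerm_of_pos ha).comp continuous_norm).sub ?_
  rw [continuous_iff_continuousAt]
  intro x
  have h1 : ContinuousAt (fun x : Rn d => √(‖x‖ ^ 2 + δ)) x := by fun_prop
  exact ContinuousAt.comp (f := fun x : Rn d => √(‖x‖ ^ 2 + δ))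
    (continuousAt_powerTerm b (Real.sqrt_pos.2 (by positivity))) h1

theorem regPotential_zero (a b : ℝ) (x : Rn d) :
    regPotential a b 0 x = powerTerm a ‖x‖ - powerTerm b ‖x‖ := by
  rw [regPotential, add_zero, Real.sqrt_sq (norm_nonneg x)]

theorem toReal_powerLaw (a b : ℝ) (x : Rn d) :
    (powerLaw d a b x).toReal = regPotential a b 0 x := by
  rw [regPotential_zero]
  unfold powerLaw
  split_ifs with h
  · rw [h.1, norm_zero, powerTerm_zero, powerTerm_zero]
    simp
  · exact EReal.toReal_coe _

/-- The attractive part dominates at infinity. -/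
theorem exists_powerTerm_le {a b : ℝ} (ha : 1 < a) (hba : b < a) {ε : ℝ} (hε : 0 < ε) :
    ∃ C, 0 ≤ C ∧ ∀ r, 0 ≤ r → powerTerm b r ≤ ε * r ^ a + C := by
  have pos : ∀ b : ℝ, 0 < b → b < a → ∃ C, 0 ≤ C ∧ ∀ r, 0 ≤ r → r ^ b / b ≤ ε * r ^ a + C := by
    intro b hb hba
    have hlim := tendsto_rpow_atTop (sub_pos.2 hba)
    obtain ⟨R, hR⟩ := ((hlim.eventually_ge_atTop (1 / (b * ε))).and
      (eventually_ge_atTop 1)).exists_forall_of_atTop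
    refine ⟨R ^ b / b, div_nonneg (Real.rpow_nonneg (by linarith [(hR R le_rfl).2]) _) hb.le, ?_⟩
    intro r hr
    have hR0 : 0 ≤ R := by linarith [(hR R le_rfl).2]
    have h0 : 0 ≤ R ^ b / b := div_nonneg (Real.rpow_nonneg hR0 _) hb.le
    have h0' : 0 ≤ ε * r ^ a := mul_nonneg hε.le (Real.rpow_nonneg hr _)
    rcases le_total r R with h | h
    · have : r ^ b / b ≤ R ^ b / b := by
        have := Real.rpow_le_rpow hr h hb.le
        gcongr
      linarith
    · obtain ⟨h1, h2⟩ := hR r h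
      have hr0 : 0 < r := by linarith
      have e : r ^ a = r ^ (a - b) * r ^ b := by
        rw [← Real.rpow_add hr0]
        ring_nf
      have hp := Real.rpow_pos_of_pos hr0 b
      have : r ^ b / b ≤ ε * r ^ a := by
        rw [e]
        calc r ^ b / b = ε * (1 / (b * ε) * r ^ b) := by field_simp
          _ ≤ ε * (r ^ (a - b) * r ^ b) := by gcongr
      linarith
  rcases lt_trichotomy b 0 with h | h | h
  · refine ⟨0, le_rfl, fun r hr => ?_⟩
    rw [powerTerm, if_neg h.ne]
    have h1 : r ^ b / b ≤ 0 := div_nonpos_of_nonneg_of_nonpos (Real.rpow_nonneg hr _) h.le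
    have h0' : 0 ≤ ε * r ^ a := mul_nonneg hε.le (Real.rpow_nonneg hr _)
    linarith
  · obtain ⟨C, hC, H⟩ := pos 1 one_pos ha
    refine ⟨C, hC, fun r hr => ?_⟩
    rw [powerTerm, if_pos h]
    have h1 := H r hr
    rw [Real.rpow_one, div_one] at h1
    exact (Real.log_le_self hr).trans h1
  · obtain ⟨C, hC, H⟩ := pos b h hba
    refine ⟨C, hC, fun r hr => ?_⟩
    rw [powerTerm, if_neg h.ne']
    exact H r hr

theorem add_rpow_le {a r s : ℝ} (ha : 0 ≤ a) (hr : 0 ≤ r) (hs : 0 ≤ s) :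
    (r + s) ^ a ≤ 2 ^ a * (r ^ a + s ^ a) := by
  have h1 : r + s ≤ 2 * max r s := by linarith [le_max_left r s, le_max_right r s]
  have hm : (max r s) ^ a ≤ r ^ a + s ^ a := by
    have := Real.rpow_nonneg hr a
    have := Real.rpow_nonneg hs a
    rcases max_choice r s with h | h <;> rw [h] <;> linarith
  calc (r + s) ^ a ≤ (2 * max r s) ^ a := Real.rpow_le_rpow (by positivity) h1 ha
    _ = 2 ^ a * (max r s) ^ a := Real.mul_rpow (by norm_num) (hr.trans (le_max_left r s))
    _ ≤ _ := by gcongr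

/-- The regularized potentials are bounded below by half the attractive part, uniformly in the
regularization. -/
theorem exists_le_regPotential {a b : ℝ} (ha : 1 < a) (hba : b < a) :
    ∃ C, 0 ≤ C ∧ ∀ (d : ℕ) (δ : ℝ) (x : Rn d), 0 ≤ δ → δ ≤ 1 →
      ‖x‖ ^ a / (2 * a) ≤ regPotential a b δ x + C := by
  have ha0 : 0 < a := by linarith
  have h2 : (0 : ℝ) < 2 ^ a := Real.rpow_pos_of_pos (by norm_num) a
  -- With this factor, `ε (|x| + 1) ^ a` is at most `|x| ^ a / (2 a)` up to a constant.
  obtain ⟨C, hC, H⟩ := exists_powerTerm_le (ε := 1 / (2 ^ a * (2 * a))) ha hba (by positivity)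
  refine ⟨1 / (2 * a) + C, by positivity, fun d δ x h0 h1 => ?_⟩
  set r := ‖x‖ with hr
  have hr0 : 0 ≤ r := norm_nonneg x
  have hs : √(r ^ 2 + δ) ≤ r + 1 := by
    rw [Real.sqrt_le_left (by positivity)]
    nlinarith
  have h3 := H (√(r ^ 2 + δ)) (Real.sqrt_nonneg _)
  have h4 : √(r ^ 2 + δ) ^ a ≤ 2 ^ a * (r ^ a + 1) := by
    calc √(r ^ 2 + δ) ^ a ≤ (r + 1) ^ a := Real.rpow_le_rpow (Real.sqrt_nonneg _) hs ha0.le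
      _ ≤ 2 ^ a * (r ^ a + 1 ^ a) := add_rpow_le ha0.le hr0 zero_le_one
      _ = _ := by rw [Real.one_rpow]
  have h5 : 1 / (2 ^ a * (2 * a)) * √(r ^ 2 + δ) ^ a ≤ (r ^ a + 1) / (2 * a) := by
    calc _ ≤ 1 / (2 ^ a * (2 * a)) * (2 ^ a * (r ^ a + 1)) := by gcongr
      _ = _ := by field_simp
  have h6 : r ^ a / a = r ^ a / (2 * a) + r ^ a / (2 * a) := by field_simp; ring
  rw [regPotential, powerTerm_of_pos ha0, ← hr, h6]
  rw [add_div] at h5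
  linarith

/-- Regularization decreases the potential where it is finite. -/
theorem regPotential_le {a b δ : ℝ} (hδ : 0 ≤ δ) {x : Rn d} (hx : ¬(x = 0 ∧ b ≤ 0)) :
    regPotential a b δ x ≤ regPotential a b 0 x := by
  unfold regPotential
  refine sub_le_sub_left ?_ _
  have hs : √(‖x‖ ^ 2 + 0) ≤ √(‖x‖ ^ 2 + δ) := Real.sqrt_le_sqrt (by linarith)
  by_cases h0 : x = 0
  · have hb : 0 < b := by
      by_contra h
      exact hx ⟨h0, not_lt.1 h⟩
    rw [powerTerm_of_pos hb, powerTerm_of_pos hb]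
    have := Real.rpow_le_rpow (Real.sqrt_nonneg _) hs hb.le
    gcongr
  · refine powerTerm_mono b (Real.sqrt_pos.2 ?_) hs
    have := norm_pos_iff.2 h0
    positivity

/-! ### The shifted potential -/

/-- The potential plus a constant `C`, as a nonnegative function with values in `[0, ∞]`.  It is
used for `C` so large that nothing is cut off. -/
def shiftedPotential (d : ℕ) (a b C : ℝ) (x : Rn d) : ℝ≥0∞ :=
  (powerLaw d a b x + (C : EReal)).toENNReal

theorem shiftedPotential_of_sing (a C : ℝ) {b : ℝ} {x : Rn d} (hx : x = 0 ∧ b ≤ 0) :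
    shiftedPotential d a b C x = ⊤ := by
  rw [shiftedPotential, powerLaw, if_pos hx]
  simp

theorem shiftedPotential_of_not_sing (a C : ℝ) {b : ℝ} {x : Rn d} (hx : ¬(x = 0 ∧ b ≤ 0)) :
    shiftedPotential d a b C x = ENNReal.ofReal (regPotential a b 0 x + C) := by
  rw [shiftedPotential, powerLaw, if_neg hx, regPotential_zero, ← EReal.coe_add]
  exact EReal.toENNReal_of_ne_top (EReal.coe_ne_top _)

theorem ofReal_regPotential_le (a b C : ℝ) {δ : ℝ} (hδ : 0 ≤ δ) (x : Rn d) :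
    ENNReal.ofReal (regPotential a b δ x + C) ≤ shiftedPotential d a b C x := by
  by_cases hx : x = 0 ∧ b ≤ 0
  · rw [shiftedPotential_of_sing a C hx]
    exact le_top
  · rw [shiftedPotential_of_not_sing a C hx]
    exact ENNReal.ofReal_le_ofReal (by linarith [regPotential_le (a := a) hδ hx])

@[fun_prop]
theorem measurable_powerLaw (d : ℕ) (a b : ℝ) : Measurable (powerLaw d a b) := by
  unfold powerLaw
  refine Measurable.ite ?_ measurable_const (by fun_prop)
  by_cases hb : b ≤ 0
  · simp [hb]
  · simp [hb]

@[fun_prop]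
theorem measurable_shiftedPotential (d : ℕ) (a b C : ℝ) :
    Measurable (shiftedPotential d a b C) := by
  have : Measurable fun x : Rn d => powerLaw d a b x + (C : EReal) :=
    (measurable_powerLaw d a b).add_const _
  exact this.ereal_toENNReal

/-- The regularized potentials converge to the potential, also at a singularity. -/
theorem tendsto_ofReal_regPotential (a b C : ℝ) {δ : ℕ → ℝ} (hδ : ∀ n, 0 < δ n)
    (hlim : Tendsto δ atTop (𝓝 0)) (x : Rn d) :
    Tendsto (fun n => ENNReal.ofReal (regPotential a b (δ n) x + C)) atTop
      (𝓝 (shiftedPotential d a b C x)) := by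
  have hs : Tendsto (fun n => √(‖x‖ ^ 2 + δ n)) atTop (𝓝 ‖x‖) := by
    have h1 : Tendsto (fun n => ‖x‖ ^ 2 + δ n) atTop (𝓝 (‖x‖ ^ 2)) := by
      simpa using hlim.const_add (‖x‖ ^ 2)
    have := h1.sqrt
    rwa [Real.sqrt_sq (norm_nonneg x)] at this
  by_cases hx : x = 0 ∧ b ≤ 0
  · rw [shiftedPotential_of_sing a C hx]
    refine ENNReal.tendsto_ofReal_nhds_top.2 ?_
    have hs0 : Tendsto (fun n => √(‖x‖ ^ 2 + δ n)) atTop (𝓝[>] 0) := by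
      rw [hx.1, norm_zero] at hs ⊢
      refine tendsto_nhdsWithin_iff.2 ⟨hs, Eventually.of_forall fun n => Real.sqrt_pos.2 ?_⟩
      have := hδ n
      positivity
    have hb : Tendsto (fun r => -powerTerm b r) (𝓝[>] 0) atTop := by
      unfold powerTerm
      rcases lt_or_eq_of_le hx.2 with hb | hb
      · simp only [if_neg hb.ne]
        have := (tendsto_rpow_neg_nhdsGT_zero hb).atTop_mul_const (r := -b⁻¹)
          (by have := inv_lt_zero.2 hb; linarith)
        refine this.congr fun r => ?_
        ring
      · simp only [if_pos hb]
        exact tendsto_neg_atBot_atTop.comp Real.tendsto_log_nhdsGT_zero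
    have h2 := tendsto_atTop_add_const_right _ (powerTerm a ‖x‖ + C) (hb.comp hs0)
    refine h2.congr fun n => ?_
    simp only [Function.comp_apply, regPotential]
    ring
  · rw [shiftedPotential_of_not_sing a C hx]
    refine (ENNReal.continuous_ofReal.tendsto _).comp (Tendsto.add_const C ?_)
    rw [regPotential_zero]
    refine Tendsto.const_sub _ ?_
    have hc : ContinuousAt (powerTerm b) ‖x‖ := by
      by_cases h0 : x = 0
      · have hb : 0 < b := by
          by_contra h
          exact hx ⟨h0, not_lt.1 h⟩
        exact (continuous_powerTerm_of_pos hb).continuousAt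
      · exact continuousAt_powerTerm b (norm_pos_iff.2 h0)
    exact hc.tendsto.comp hs

/-! ### Shifted energies -/

/-- The constant `C` is large enough for the potential and its regularizations to stay above half
the attractive part after adding `C`. -/
def IsShift (a b C : ℝ) : Prop :=
  0 ≤ C ∧ ∀ (d : ℕ) (δ : ℝ) (x : Rn d), 0 ≤ δ → δ ≤ 1 →
    ‖x‖ ^ a / (2 * a) ≤ regPotential a b δ x + C

/-- The double integral of the shifted potential against two positive measures. -/
def crossEnergy (a b C : ℝ) (α β : Measure (Rn d)) : ℝ≥0∞ :=
  ∫⁻ z, shiftedPotential d a b C (z.1 - z.2) ∂α.prod β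

theorem IsShift.add_nonneg {a b C : ℝ} (hC : IsShift a b C) (ha : 0 < a) {δ : ℝ} (h0 : 0 ≤ δ)
    (h1 : δ ≤ 1) (x : Rn d) : 0 ≤ regPotential a b δ x + C :=
  le_trans (by positivity) (hC.2 d δ x h0 h1)

section lintegral

variable {a b C : ℝ} {μ : Measure (Rn d × Rn d)}

theorem lintegral_shiftedPotential_add (hC : IsShift a b C) (ha : 0 < a) :
    ∫⁻ z, shiftedPotential d a b C (z.1 - z.2) ∂μ +
        ∫⁻ z, (-powerLaw d a b (z.1 - z.2)).toENNReal ∂μ =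
      ∫⁻ z, (powerLaw d a b (z.1 - z.2)).toENNReal ∂μ + ENNReal.ofReal C * μ univ := by
  rw [← lintegral_const, ← lintegral_add_left (by fun_prop),
    ← lintegral_add_right _ measurable_const]
  refine lintegral_congr fun z => ?_
  generalize z.1 - z.2 = x
  by_cases hx : x = 0 ∧ b ≤ 0
  · rw [shiftedPotential_of_sing a C hx, powerLaw, if_pos hx]
    simp
  · rw [shiftedPotential_of_not_sing a C hx, powerLaw, if_neg hx, ← regPotential_zero,
      ← EReal.coe_neg, EReal.toENNReal_of_ne_top (EReal.coe_ne_top _),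
      EReal.toENNReal_of_ne_top (EReal.coe_ne_top _), EReal.toReal_coe, EReal.toReal_coe]
    have h := hC.add_nonneg ha le_rfl zero_le_one x
    have h0 := hC.1
    rcases le_total 0 (regPotential a b 0 x) with h1 | h1
    · rw [ENNReal.ofReal_of_nonpos (neg_nonpos.2 h1), add_zero, ENNReal.ofReal_add h1 h0]
    · rw [ENNReal.ofReal_of_nonpos h1, zero_add,
        ← ENNReal.ofReal_add h (neg_nonneg.2 h1)]
      ring_nf

theorem lintegral_neg_powerLaw_lt_top [IsFiniteMeasure μ] (hC : IsShift a b C) (ha : 0 < a) :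
    ∫⁻ z, (-powerLaw d a b (z.1 - z.2)).toENNReal ∂μ < ⊤ := by
  refine lt_of_le_of_lt (lintegral_mono (g := fun _ => ENNReal.ofReal C) fun z => ?_) ?_
  · simp only
    generalize z.1 - z.2 = x
    by_cases hx : x = 0 ∧ b ≤ 0
    · rw [powerLaw, if_pos hx]
      simp
    · rw [powerLaw, if_neg hx, ← regPotential_zero, ← EReal.coe_neg,
        EReal.toENNReal_of_ne_top (EReal.coe_ne_top _), EReal.toReal_coe]
      exact ENNReal.ofReal_le_ofReal (by linarith [hC.add_nonneg ha le_rfl zero_le_one x])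
  · rw [lintegral_const]
    exact ENNReal.mul_lt_top ENNReal.ofReal_lt_top (measure_lt_top _ _)

theorem ae_not_sing (h : ∫⁻ z, shiftedPotential d a b C (z.1 - z.2) ∂μ < ⊤) :
    ∀ᵐ z ∂μ, ¬(z.1 - z.2 = 0 ∧ b ≤ 0) := by
  filter_upwards [ae_lt_top (by fun_prop) h.ne] with z hz hs
  rw [shiftedPotential_of_sing a C hs] at hz
  exact lt_irrefl _ hz

theorem lintegral_ofReal_regPotential
    (h : ∫⁻ z, shiftedPotential d a b C (z.1 - z.2) ∂μ < ⊤) :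
    ∫⁻ z, ENNReal.ofReal (regPotential a b 0 (z.1 - z.2) + C) ∂μ =
      ∫⁻ z, shiftedPotential d a b C (z.1 - z.2) ∂μ := by
  refine lintegral_congr_ae ?_
  filter_upwards [ae_not_sing h] with z hz
  rw [shiftedPotential_of_not_sing a C hz]

theorem integrable_regPotential_add (hC : IsShift a b C) (ha : 0 < a)
    (h : ∫⁻ z, shiftedPotential d a b C (z.1 - z.2) ∂μ < ⊤) :
    Integrable (fun z : Rn d × Rn d => regPotential a b 0 (z.1 - z.2) + C) μ := by
  refine ⟨Measurable.aestronglyMeasurable (by fun_prop), ?_⟩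
  have hn : ∀ z : Rn d × Rn d, 0 ≤ regPotential a b 0 (z.1 - z.2) + C := fun z =>
    hC.add_nonneg ha le_rfl zero_le_one (z.1 - z.2)
  rw [hasFiniteIntegral_iff_ofReal (ae_of_all _ hn), lintegral_ofReal_regPotential h]
  exact h

theorem toReal_lintegral_shiftedPotential (hC : IsShift a b C) (ha : 0 < a)
    (h : ∫⁻ z, shiftedPotential d a b C (z.1 - z.2) ∂μ < ⊤) :
    (∫⁻ z, shiftedPotential d a b C (z.1 - z.2) ∂μ).toReal =
      ∫ z, (regPotential a b 0 (z.1 - z.2) + C) ∂μ := by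
  have hn : ∀ z : Rn d × Rn d, 0 ≤ regPotential a b 0 (z.1 - z.2) + C := fun z =>
    hC.add_nonneg ha le_rfl zero_le_one (z.1 - z.2)
  rw [integral_eq_lintegral_of_nonneg_ae (ae_of_all _ hn)
    (Measurable.aestronglyMeasurable (by fun_prop)), lintegral_ofReal_regPotential h]

theorem integrable_norm_rpow_of_lt_top (hC : IsShift a b C) (ha : 0 < a)
    (h : ∫⁻ z, shiftedPotential d a b C (z.1 - z.2) ∂μ < ⊤) :
    Integrable (fun z : Rn d × Rn d => ‖z.1 - z.2‖ ^ a) μ := by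
  refine ((integrable_regPotential_add hC ha h).const_mul (2 * a)).mono'
    (Measurable.aestronglyMeasurable (by fun_prop)) (ae_of_all _ fun z => ?_)
  have := hC.2 d 0 (z.1 - z.2) le_rfl zero_le_one
  rw [Real.norm_of_nonneg (by positivity)]
  rwa [div_le_iff₀ (by positivity), mul_comm] at this

theorem integrable_regPotential [IsFiniteMeasure μ] (hC : IsShift a b C) (ha : 0 < a)
    (h : ∫⁻ z, shiftedPotential d a b C (z.1 - z.2) ∂μ < ⊤) :
    Integrable (fun z : Rn d × Rn d => regPotential a b 0 (z.1 - z.2)) μ := by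
  have := (integrable_regPotential_add hC ha h).sub (integrable_const C)
  exact this.congr (ae_of_all _ fun z => by simp)

end lintegral

theorem energy_eq_of_isProbabilityMeasure {a b C : ℝ} (hC : IsShift a b C) (ha : 0 < a)
    (ρ : Measure (Rn d)) [IsProbabilityMeasure ρ] :
    energy (powerLaw d a b) ρ =
      ((1 / 2 : ℝ) : EReal) * ((crossEnergy a b C ρ ρ : EReal) - (C : EReal)) := by
  have h1 := lintegral_shiftedPotential_add (μ := ρ.prod ρ) hC ha
  have h2 := lintegral_neg_powerLaw_lt_top (μ := ρ.prod ρ) hC ha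
  rw [energy, crossEnergy]
  congr 1
  rw [measure_univ, mul_one] at h1
  generalize ∫⁻ z, shiftedPotential d a b C (z.1 - z.2) ∂ρ.prod ρ = J at *
  generalize ∫⁻ z, (-powerLaw d a b (z.1 - z.2)).toENNReal ∂ρ.prod ρ = N at *
  generalize ∫⁻ z, (powerLaw d a b (z.1 - z.2)).toENNReal ∂ρ.prod ρ = P at *
  have hN := h2.ne
  lift N to NNReal using hN
  by_cases hP : P = ⊤
  · have hJ : J = ⊤ := by
      rw [hP, top_add] at h1
      simpa using ENNReal.add_eq_top.1 h1
    rw [hP, hJ]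
    rfl
  · have hJ : J ≠ ⊤ := by
      rintro rfl
      rw [top_add] at h1
      have := ENNReal.add_lt_top.2 ⟨lt_top_iff_ne_top.2 hP, ENNReal.ofReal_lt_top (r := C)⟩
      exact this.ne h1.symm
    lift P to NNReal using hP
    lift J to NNReal using hJ
    have h3 := congrArg ENNReal.toReal h1
    rw [ENNReal.toReal_add (by simp) (by simp), ENNReal.toReal_add (by simp) (by simp),
      ENNReal.toReal_ofReal hC.1] at h3
    simp only [ENNReal.coe_toReal] at h3
    have e : ∀ x : NNReal, ((x : ℝ≥0∞) : EReal) = ((x : ℝ) : EReal) := fun x => rfl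
    rw [e, e, e, ← EReal.coe_sub, ← EReal.coe_sub]
    congr 1
    linarith

/-- For probability measures, comparing energies amounts to comparing shifted energies. -/
theorem energy_le_energy_iff {a b C : ℝ} (hC : IsShift a b C) (ha : 0 < a)
    (ρ ν : Measure (Rn d)) [IsProbabilityMeasure ρ] [IsProbabilityMeasure ν] :
    energy (powerLaw d a b) ρ ≤ energy (powerLaw d a b) ν ↔
      crossEnergy a b C ρ ρ ≤ crossEnergy a b C ν ν := by
  rw [energy_eq_of_isProbabilityMeasure hC ha, energy_eq_of_isProbabilityMeasure hC ha]
  generalize crossEnergy a b C ρ ρ = x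
  generalize crossEnergy a b C ν ν = y
  have e : ∀ x : NNReal, ((x : ℝ≥0∞) : EReal) = ((x : ℝ) : EReal) := fun x => rfl
  have htop : ((1 / 2 : ℝ) : EReal) * (((⊤ : ℝ≥0∞) : EReal) - (C : EReal)) = ⊤ := by
    have : (((⊤ : ℝ≥0∞) : EReal) - (C : EReal)) = ⊤ := rfl
    rw [this]
    exact EReal.coe_mul_top_of_pos (by norm_num)
  by_cases hy : y = ⊤
  · rw [hy, htop]
    simp
  by_cases hx : x = ⊤
  · rw [hx, htop]
    lift y to NNReal using hy
    rw [e, ← EReal.coe_sub, ← EReal.coe_mul]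
    exact ⟨fun h => absurd (top_le_iff.1 h) (EReal.coe_ne_top _),
      fun h => absurd (top_le_iff.1 h) ENNReal.coe_ne_top⟩
  lift x to NNReal using hx
  lift y to NNReal using hy
  rw [e, e, ← EReal.coe_sub, ← EReal.coe_mul, ← EReal.coe_sub, ← EReal.coe_mul,
    EReal.coe_le_coe_iff, ENNReal.coe_le_coe, ← NNReal.coe_le_coe]
  constructor <;> intro h <;> linarith

theorem crossEnergy_lt_top_of_energy_lt_top {a b C : ℝ} (hC : IsShift a b C) (ha : 0 < a)
    (m : Measure (Rn d)) [IsFiniteMeasure m] (h : energy (powerLaw d a b) m < ⊤) :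
    crossEnergy a b C m m < ⊤ := by
  have h1 := lintegral_shiftedPotential_add (μ := m.prod m) hC ha
  have h2 := lintegral_neg_powerLaw_lt_top (μ := m.prod m) hC ha
  have hm : ENNReal.ofReal C * (m.prod m) univ < ⊤ :=
    ENNReal.mul_lt_top ENNReal.ofReal_lt_top (measure_lt_top _ _)
  rw [energy] at h
  rw [crossEnergy]
  generalize ∫⁻ z, (-powerLaw d a b (z.1 - z.2)).toENNReal ∂m.prod m = N at *
  generalize ∫⁻ z, (powerLaw d a b (z.1 - z.2)).toENNReal ∂m.prod m = P at *
  have hP : P ≠ ⊤ := by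
    rintro rfl
    have hN := h2.ne
    lift N to NNReal using hN
    have : (((⊤ : ℝ≥0∞) : EReal) - ((N : ℝ≥0∞) : EReal)) = ⊤ := rfl
    rw [this, EReal.coe_mul_top_of_pos (by norm_num)] at h
    exact lt_irrefl _ h
  refine lt_of_le_of_lt (le_self_add.trans h1.le) ?_
  exact ENNReal.add_lt_top.2 ⟨lt_top_iff_ne_top.2 hP, hm⟩

theorem crossEnergy_comm (a b C : ℝ) (α β : Measure (Rn d)) [SFinite α] [SFinite β] :
    crossEnergy a b C α β = crossEnergy a b C β α := by
  rw [crossEnergy, ← lintegral_prod_swap, crossEnergy]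
  refine lintegral_congr fun z => ?_
  have e : powerLaw d a b (z.2 - z.1) = powerLaw d a b (z.1 - z.2) := by
    simp only [powerLaw, norm_sub_rev z.2 z.1, sub_eq_zero, eq_comm (a := z.2)]
  simp only [shiftedPotential, Prod.fst_swap, Prod.snd_swap, e]

theorem crossEnergy_add_add (a b C : ℝ) (α β : Measure (Rn d)) [SFinite α] [SFinite β] :
    crossEnergy a b C (α + β) (α + β) =
      crossEnergy a b C α α + crossEnergy a b C β α +
        (crossEnergy a b C α β + crossEnergy a b C β β) := by
  simp only [crossEnergy]
  rw [Measure.prod_add, Measure.add_prod, Measure.add_prod, lintegral_add_measure,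
    lintegral_add_measure, lintegral_add_measure]

theorem crossEnergy_smul_smul (a b C : ℝ) (c : ℝ≥0∞) (α : Measure (Rn d)) [SFinite α] :
    crossEnergy a b C (c • α) (c • α) = c * (c * crossEnergy a b C α α) := by
  simp only [crossEnergy]
  rw [Measure.prod_smul_left, Measure.prod_smul_right, lintegral_smul_measure,
    lintegral_smul_measure, smul_eq_mul, smul_eq_mul]

/-! ### Moments of measures of finite energy -/

section moments

variable {a b C : ℝ} {α β : Measure (Rn d)} [IsFiniteMeasure α] [IsFiniteMeasure β]

theorem integrable_norm_rpow_of_crossEnergy_lt_top (hC : IsShift a b C) (ha : 0 < a)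
    (h : crossEnergy a b C α α < ⊤) : Integrable (fun x : Rn d => ‖x‖ ^ a) α := by
  rcases eq_or_ne α 0 with rfl | h0
  · exact integrable_zero_measure
  have hi := (integrable_norm_rpow_of_lt_top hC ha h).prod_left_ae
  have : NeZero α := ⟨h0⟩
  obtain ⟨y, hy⟩ := hi.exists
  refine ((hy.add (integrable_const (‖y‖ ^ a))).const_mul (2 ^ a)).mono'
    (Measurable.aestronglyMeasurable (by fun_prop)) (ae_of_all _ fun x => ?_)
  rw [Real.norm_of_nonneg (by positivity)]
  calc ‖x‖ ^ a ≤ (‖x - y‖ + ‖y‖) ^ a := by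
        refine Real.rpow_le_rpow (norm_nonneg _) ?_ ha.le
        simpa using norm_add_le (x - y) y
    _ ≤ _ := add_rpow_le ha.le (norm_nonneg _) (norm_nonneg _)

theorem integrable_norm_sq_of_rpow (ha : 2 ≤ a) (h : Integrable (fun x : Rn d => ‖x‖ ^ a) α) :
    Integrable (fun x : Rn d => ‖x‖ ^ 2) α := by
  refine ((integrable_const (1 : ℝ)).add h).mono' (by fun_prop) (ae_of_all _ fun x => ?_)
  rw [Real.norm_of_nonneg (by positivity)]
  simp only [Pi.add_apply]
  rcases le_total ‖x‖ 1 with h1 | h1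
  · have : ‖x‖ ^ 2 ≤ 1 := pow_le_one₀ (norm_nonneg x) h1
    have := Real.rpow_nonneg (norm_nonneg x) a
    linarith
  · have := Real.rpow_le_rpow_of_exponent_le h1 ha
    have e : ‖x‖ ^ (2 : ℝ) = ‖x‖ ^ 2 := by norm_cast
    rw [e] at this
    linarith

theorem integrable_norm_sub_rpow (ha : 0 < a) (h : Integrable (fun x : Rn d => ‖x‖ ^ a) α)
    (h' : Integrable (fun x : Rn d => ‖x‖ ^ a) β) :
    Integrable (fun z : Rn d × Rn d => ‖z.1 - z.2‖ ^ a) (α.prod β) := by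
  have h1 : Integrable (fun z : Rn d × Rn d => ‖z.1‖ ^ a) (α.prod β) := h.comp_fst β
  have h2 : Integrable (fun z : Rn d × Rn d => ‖z.2‖ ^ a) (α.prod β) := h'.comp_snd α
  refine ((h1.add h2).const_mul (2 ^ a)).mono'
    (Measurable.aestronglyMeasurable (by fun_prop)) (ae_of_all _ fun z => ?_)
  rw [Real.norm_of_nonneg (by positivity)]
  calc ‖z.1 - z.2‖ ^ a ≤ (‖z.1‖ + ‖z.2‖) ^ a :=
        Real.rpow_le_rpow (norm_nonneg _) (norm_sub_le _ _) ha.le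
    _ ≤ _ := add_rpow_le ha.le (norm_nonneg _) (norm_nonneg _)

/-! ### Convexity of the energy -/

theorem discrepancy_regPotential {δ : ℝ} (ha : 0 < a)
    (h1 : Integrable (fun z : Rn d × Rn d => ‖z.1 - z.2‖ ^ a) ((α + β).prod (α + β)))
    (h2 : Integrable (fun z : Rn d × Rn d => regPotential a b δ (z.1 - z.2))
      ((α + β).prod (α + β))) :
    Integrable (fun z : Rn d × Rn d => -powerTerm b (√(‖z.1 - z.2‖ ^ 2 + δ)))
        ((α + β).prod (α + β)) ∧
      discrepancy (regPotential a b δ) α β = a⁻¹ * discrepancy (fun x => ‖x‖ ^ a) α β +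
        discrepancy (fun x => -powerTerm b (√(‖x‖ ^ 2 + δ))) α β := by
  have h3 : Integrable (fun z : Rn d × Rn d => a⁻¹ * ‖z.1 - z.2‖ ^ a) ((α + β).prod (α + β)) :=
    h1.const_mul a⁻¹
  have h4 : Integrable (fun z : Rn d × Rn d => -powerTerm b (√(‖z.1 - z.2‖ ^ 2 + δ)))
      ((α + β).prod (α + β)) := by
    refine (h2.sub h3).congr (ae_of_all _ fun z => ?_)
    simp only [Pi.sub_apply, regPotential, powerTerm_of_pos ha]
    ring
  refine ⟨h4, ?_⟩
  rw [← discrepancy_const_mul, ← discrepancy_add h3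
    (l := fun x : Rn d => -powerTerm b (√(‖x‖ ^ 2 + δ))) h4]
  congr 1
  ext x
  simp only [regPotential, powerTerm_of_pos ha]
  ring

/-- The discrepancy for the regularized potential is nonnegative. -/
theorem IsBalanced.discrepancy_regPotential_nonneg (h : IsBalanced α β) (ha2 : 2 ≤ a)
    (ha4 : a ≤ 4) (hb : b < 2) {δ : ℝ} (hδ : 0 < δ)
    (h1 : Integrable (fun z : Rn d × Rn d => ‖z.1 - z.2‖ ^ a) ((α + β).prod (α + β)))
    (h2 : Integrable (fun z : Rn d × Rn d => regPotential a b δ (z.1 - z.2))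
      ((α + β).prod (α + β))) :
    0 ≤ discrepancy (regPotential a b δ) α β := by
  have ha : 0 < a := by linarith
  obtain ⟨i, e⟩ := discrepancy_regPotential ha h1 h2
  obtain ⟨w, f, q, H⟩ := exists_isGaussianMixture_neg_powerTerm hb
  have H' := H.comp_add (T := Ici 0) (δ := δ) fun s hs =>
    ⟨add_nonneg hs hδ.le, fun _ => add_pos_of_nonneg_of_pos hs hδ⟩
  have h3 := H'.discrepancy_nonneg h (ae_of_all _ fun z => sq_nonneg ‖z.1 - z.2‖) i
  have h4 := h.discrepancy_norm_rpow_nonneg ha2 ha4 h1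
  rw [e]
  positivity

/-- The discrepancy for the potential controls the low frequencies. -/
theorem exists_le_discrepancy_regPotential (hC : IsShift a b C) (ha2 : 2 ≤ a)
    (ha4 : a ≤ 4) (hb : b < 2) (d : ℕ) (R : ℝ) :
    ∃ c : ℝ, 0 < c ∧ ∀ α β : Measure (Rn d), ∀ [IsFiniteMeasure α], ∀ [IsFiniteMeasure β],
      IsBalanced α β → crossEnergy a b C (α + β) (α + β) < ⊤ →
      c * ∫ v in {v : Rn d | ‖v‖ ≤ R}, ‖charFun α v - charFun β v‖ ^ 2 ≤
        discrepancy (regPotential a b 0) α β := by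
  have ha : 0 < a := by linarith
  obtain ⟨w, f, q, H⟩ := exists_isGaussianMixture_neg_powerTerm hb
  obtain ⟨c, hc, Hc⟩ := H.exists_le_discrepancy d R
  refine ⟨c, hc, fun α β _ _ h hE => ?_⟩
  have h1 := integrable_norm_rpow_of_lt_top hC ha hE
  obtain ⟨i, e⟩ := discrepancy_regPotential ha h1 (integrable_regPotential hC ha hE)
  simp only [add_zero] at i e
  have h4 := h.discrepancy_norm_rpow_nonneg ha2 ha4 h1
  have hS : ∀ᵐ z ∂(α + β).prod (α + β),
      ‖z.1 - z.2‖ ^ 2 ∈ {s : ℝ | 0 ≤ s ∧ (b ≤ 0 → 0 < s)} := by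
    filter_upwards [ae_not_sing hE] with z hz
    refine ⟨sq_nonneg _, fun hb => ?_⟩
    have : z.1 - z.2 ≠ 0 := fun h => hz ⟨h, hb⟩
    have := norm_pos_iff.2 this
    positivity
  have h5 := Hc α β h hS i
  rw [e]
  have : 0 ≤ a⁻¹ * discrepancy (fun x => ‖x‖ ^ a) α β := by positivity
  linarith

theorem isBalanced_of_crossEnergy_lt_top (hC : IsShift a b C) (ha2 : 2 ≤ a)
    (hm : α univ = β univ) (hα : crossEnergy a b C α α < ⊤) (hβ : crossEnergy a b C β β < ⊤)
    (he : ∫ x, x ∂α = ∫ x, x ∂β) : IsBalanced α β :=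
  ⟨hm, integrable_norm_sq_of_rpow ha2
      (integrable_norm_rpow_of_crossEnergy_lt_top hC (by linarith) hα),
    integrable_norm_sq_of_rpow ha2
      (integrable_norm_rpow_of_crossEnergy_lt_top hC (by linarith) hβ), he⟩

/-- The mutual energy of balanced measures of finite energy is finite: for the regularized
potentials it is controlled by the self-energies because of positivity, and the regularization
is removed by Fatou's lemma. -/
theorem IsBalanced.crossEnergy_lt_top (h : IsBalanced α β) (hC : IsShift a b C) (ha2 : 2 ≤ a)
    (ha4 : a ≤ 4) (hb : b < 2)
    (hα : crossEnergy a b C α α < ⊤) (hβ : crossEnergy a b C β β < ⊤) :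
    crossEnergy a b C α β < ⊤ := by
  have ha : 0 < a := by linarith
  have mα := integrable_norm_rpow_of_crossEnergy_lt_top hC ha hα
  have mβ := integrable_norm_rpow_of_crossEnergy_lt_top hC ha hβ
  have h1 : Integrable (fun z : Rn d × Rn d => ‖z.1 - z.2‖ ^ a) ((α + β).prod (α + β)) :=
    integrable_norm_sub_rpow ha (mα.add_measure mβ) (mα.add_measure mβ)
  set B : ℝ := (crossEnergy a b C α α).toReal + (crossEnergy a b C β β).toReal with hB
  have key : ∀ δ : ℝ, 0 < δ → δ ≤ 1 →
      ∫⁻ z, ENNReal.ofReal (regPotential a b δ (z.1 - z.2) + C) ∂α.prod β ≤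
        ENNReal.ofReal B := by
    intro δ h0 hδ1
    have hn : ∀ z : Rn d × Rn d, 0 ≤ regPotential a b δ (z.1 - z.2) + C := fun z =>
      hC.add_nonneg ha h0.le hδ1 (z.1 - z.2)
    have i0 : Integrable (fun z : Rn d × Rn d => regPotential a b δ (z.1 - z.2) + C)
        ((α + β).prod (α + β)) := by
      refine ((h1.const_mul a⁻¹).add (integrable_const (-powerTerm b (√δ) + C))).mono'
        (Measurable.aestronglyMeasurable (by fun_prop)) (ae_of_all _ fun z => ?_)
      rw [Real.norm_of_nonneg (hn z)]
      have hs : powerTerm b (√δ) ≤ powerTerm b (√(‖z.1 - z.2‖ ^ 2 + δ)) :=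
        powerTerm_mono b (Real.sqrt_pos.2 h0)
          (Real.sqrt_le_sqrt (by linarith [sq_nonneg ‖z.1 - z.2‖]))
      simp only [Pi.add_apply, regPotential, powerTerm_of_pos ha]
      rw [div_eq_inv_mul]
      linarith
    have i1 : Integrable (fun z : Rn d × Rn d => regPotential a b δ (z.1 - z.2))
        ((α + β).prod (α + β)) :=
      (i0.sub (integrable_const C)).congr (ae_of_all _ fun z => by simp)
    have hD := h.discrepancy_regPotential_nonneg ha2 ha4 hb h0 h1 i1
    have hD' : discrepancy (fun x => regPotential a b δ x + C) α β =
        discrepancy (regPotential a b δ) α β := by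
      rw [discrepancy_add (k := regPotential a b δ) (l := fun _ => C) i1 (integrable_const C),
        discrepancy_const h.mass_eq, add_zero]
    rw [← hD', discrepancy] at hD
    rw [integrable_add_prod_add_iff] at i0
    obtain ⟨⟨j1, j2⟩, j3, j4⟩ := i0
    have self : ∀ γ : Measure (Rn d), crossEnergy a b C γ γ < ⊤ →
        ∫ z, (regPotential a b δ (z.1 - z.2) + C) ∂γ.prod γ ≤
          (crossEnergy a b C γ γ).toReal := by
      intro γ hγ
      rw [integral_eq_lintegral_of_nonneg_ae (ae_of_all _ hn)
        (Measurable.aestronglyMeasurable (by fun_prop))]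
      refine ENNReal.toReal_mono hγ.ne (lintegral_mono fun z => ?_)
      exact ofReal_regPotential_le a b C h0.le _
    have s1 := self α hα
    have s2 := self β hβ
    have s3 : 0 ≤ ∫ z, (regPotential a b δ (z.1 - z.2) + C) ∂β.prod α := integral_nonneg hn
    rw [← ofReal_integral_eq_lintegral_ofReal j2 (ae_of_all _ hn)]
    exact ENNReal.ofReal_le_ofReal (by linarith)
  set δ : ℕ → ℝ := fun n => 1 / ((n : ℝ) + 1) with hδ
  have hδ0 : ∀ n, 0 < δ n := fun n => by simp only [hδ]; positivity
  have hδ1 : ∀ n, δ n ≤ 1 := fun n => by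
    simp only [hδ]
    rw [div_le_one (by positivity)]
    have : (0 : ℝ) ≤ n := by positivity
    linarith
  have hlim : Tendsto δ atTop (𝓝 0) := tendsto_one_div_add_atTop_nhds_zero_nat
  refine lt_of_le_of_lt ?_ (ENNReal.ofReal_lt_top (r := B))
  calc crossEnergy a b C α β
      = ∫⁻ z, liminf (fun n => ENNReal.ofReal (regPotential a b (δ n) (z.1 - z.2) + C)) atTop
          ∂α.prod β := by
        refine lintegral_congr fun z => ?_
        exact ((tendsto_ofReal_regPotential a b C hδ0 hlim (z.1 - z.2)).liminf_eq).symm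
    _ ≤ liminf (fun n => ∫⁻ z, ENNReal.ofReal (regPotential a b (δ n) (z.1 - z.2) + C)
          ∂α.prod β) atTop := lintegral_liminf_le fun n => by fun_prop
    _ ≤ ENNReal.ofReal B := by
        refine liminf_le_of_frequently_le' (Frequently.of_forall fun n => ?_)
        exact key (δ n) (hδ0 n) (hδ1 n)

theorem IsBalanced.crossEnergy_add_add_lt_top (h : IsBalanced α β) (hC : IsShift a b C)
    (ha2 : 2 ≤ a) (ha4 : a ≤ 4) (hb : b < 2)
    (hα : crossEnergy a b C α α < ⊤) (hβ : crossEnergy a b C β β < ⊤) :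
    crossEnergy a b C (α + β) (α + β) < ⊤ := by
  have hc := h.crossEnergy_lt_top hC ha2 ha4 hb hα hβ
  rw [crossEnergy_add_add, crossEnergy_comm a b C β α]
  exact ENNReal.add_lt_top.2 ⟨ENNReal.add_lt_top.2 ⟨hα, hc⟩, ENNReal.add_lt_top.2 ⟨hc, hβ⟩⟩

end moments

/-- Strict convexity of the energy along linear interpolation of probability measures with the same
center of mass. -/
theorem eq_of_crossEnergy_le_midpoint {a b C : ℝ} (hC : IsShift a b C) (ha2 : 2 ≤ a)
    (ha4 : a ≤ 4) (hb : b < 2) {ρ ν : Measure (Rn d)} [IsProbabilityMeasure ρ]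
    [IsProbabilityMeasure ν] (he : ∫ x, x ∂ρ = ∫ x, x ∂ν) (hρ : crossEnergy a b C ρ ρ < ⊤)
    (hν : crossEnergy a b C ν ν ≤ crossEnergy a b C ρ ρ)
    (hmid : crossEnergy a b C ρ ρ ≤
      crossEnergy a b C ((2⁻¹ : ℝ≥0∞) • (ρ + ν)) ((2⁻¹ : ℝ≥0∞) • (ρ + ν))) : ρ = ν := by
  have ha : 0 < a := by linarith
  have hν' := lt_of_le_of_lt hν hρ
  have hbal : IsBalanced ρ ν := isBalanced_of_crossEnergy_lt_top hC ha2 (by simp) hρ hν' he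
  have hsum := hbal.crossEnergy_add_add_lt_top hC ha2 ha4 hb hρ hν'
  have hc := hbal.crossEnergy_lt_top hC ha2 ha4 hb hρ hν'
  have hc' : crossEnergy a b C ν ρ < ⊤ := crossEnergy_comm a b C ρ ν ▸ hc
  -- The discrepancy is nonpositive.
  have hD : discrepancy (regPotential a b 0) ρ ν ≤ 0 := by
    have ireg := integrable_regPotential hC ha hsum
    have e : discrepancy (regPotential a b 0) ρ ν =
        discrepancy (fun x => regPotential a b 0 x + C) ρ ν := by
      rw [discrepancy_add (k := regPotential a b 0) (l := fun _ => C) ireg (integrable_const C),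
        discrepancy_const hbal.mass_eq, add_zero]
    rw [e, discrepancy, ← toReal_lintegral_shiftedPotential hC ha hρ,
      ← toReal_lintegral_shiftedPotential hC ha hc,
      ← toReal_lintegral_shiftedPotential hC ha hc',
      ← toReal_lintegral_shiftedPotential hC ha hν']
    change ((crossEnergy a b C ρ ρ).toReal - (crossEnergy a b C ρ ν).toReal) -
      ((crossEnergy a b C ν ρ).toReal - (crossEnergy a b C ν ν).toReal) ≤ 0
    rw [crossEnergy_smul_smul, crossEnergy_add_add] at hmid
    have h1 := ENNReal.toReal_mono hρ.ne hν
    have h2 := ENNReal.toReal_mono (by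
      have h3 : (2⁻¹ : ℝ≥0∞) < ⊤ := by simp
      refine (ENNReal.mul_lt_top h3 (ENNReal.mul_lt_top h3 ?_)).ne
      rw [← crossEnergy_add_add]
      exact hsum) hmid
    rw [ENNReal.toReal_mul, ENNReal.toReal_mul, ENNReal.toReal_add
      (ENNReal.add_lt_top.2 ⟨hρ, hc'⟩).ne (ENNReal.add_lt_top.2 ⟨hc, hν'⟩).ne,
      ENNReal.toReal_add hρ.ne hc'.ne, ENNReal.toReal_add hc.ne hν'.ne, ENNReal.toReal_inv,
      ENNReal.toReal_ofNat] at h2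
    linarith
  refine Measure.ext_of_charFun (funext fun v₀ => ?_)
  obtain ⟨c, hc0, H⟩ := exists_le_discrepancy_regPotential hC ha2 ha4 hb d (‖v₀‖ + 1)
  have h1 := (H ρ ν hbal hsum).trans hD
  set A : Set (Rn d) := {v : Rn d | ‖v‖ ≤ ‖v₀‖ + 1} with hA
  have hcont : Continuous fun v => ‖charFun ρ v - charFun ν v‖ ^ 2 := by
    have h1 := continuous_charFun ρ
    have h2 := continuous_charFun ν
    fun_prop
  have hcpt : IsCompact A := by
    have := isCompact_closedBall (0 : Rn d) (‖v₀‖ + 1)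
    simpa [hA, Metric.closedBall, dist_zero_right] using this
  have h2 : ∫ v in A, ‖charFun ρ v - charFun ν v‖ ^ 2 = 0 := by
    refine le_antisymm ?_ (integral_nonneg fun v => by positivity)
    exact nonpos_of_mul_nonpos_right h1 hc0
  rw [integral_eq_zero_iff_of_nonneg (fun v => by positivity)
    (hcont.continuousOn.integrableOn_compact hcpt)] at h2
  have h3 : (fun v => ‖charFun ρ v - charFun ν v‖ ^ 2)
      =ᵐ[volume.restrict (Metric.ball 0 (‖v₀‖ + 1))] 0 := by
    refine ae_restrict_of_ae_restrict_of_subset (fun v hv => ?_) h2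
    rw [mem_ball_zero_iff] at hv
    exact hv.le
  have h4 := Measure.eqOn_open_of_ae_eq h3 Metric.isOpen_ball hcont.continuousOn
    continuousOn_const (x := v₀) (by simp)
  have h5 : ‖charFun ρ v₀ - charFun ν v₀‖ ^ 2 = 0 := h4
  exact sub_eq_zero.1 (norm_eq_zero.1 (pow_eq_zero_iff two_ne_zero |>.1 h5))

/-! ### Signed measures -/

theorem norm_fourier_eq (μ : SignedMeasure (Rn d)) (ξ : Rn d) :
    ‖fourier μ ξ‖ = ‖charFun μ.toJordanDecomposition.posPart ξ -
      charFun μ.toJordanDecomposition.negPart ξ‖ := by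
  have e : ∀ α : Measure (Rn d),
      ∫ x, Complex.exp (-(Complex.I * ((inner ℝ x ξ : ℝ) : ℂ))) ∂α =
        (starRingEnd ℂ) (charFun α ξ) := by
    intro α
    rw [charFun_apply, ← integral_conj]
    refine integral_congr_ae (ae_of_all _ fun x => ?_)
    simp only
    rw [← Complex.exp_conj]
    congr 1
    simp [mul_comm]
  rw [fourier, signedIntegral, e, e, ← map_sub, RCLike.norm_conj]

theorem signedEnergy_powerLaw (a b : ℝ) (μ : SignedMeasure (Rn d)) :
    signedEnergy (powerLaw d a b) μ = 1 / 2 * discrepancy (regPotential a b 0)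
      μ.toJordanDecomposition.posPart μ.toJordanDecomposition.negPart := by
  simp only [signedEnergy, mutualEnergy, toReal_powerLaw, discrepancy]
  ring

theorem isFLIC_powerLaw {a b C : ℝ} (hC : IsShift a b C) (ha2 : 2 ≤ a) (ha4 : a ≤ 4)
    (hb : b < 2) : IsFLIC (powerLaw d a b) := by
  intro r R _ _
  have ha : 0 < a := by linarith
  obtain ⟨c, hc0, H⟩ := exists_le_discrepancy_regPotential hC ha2 ha4 hb d R
  refine ⟨1 / 2 * c, by positivity, fun μ hμ => ?_⟩
  set α := μ.toJordanDecomposition.posPart with hα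
  set β := μ.toJordanDecomposition.negPart with hβ
  have hfin : IsFiniteMeasure (α + β) := inferInstance
  have htv : μ.totalVariation = α + β := rfl
  have hE : crossEnergy a b C (α + β) (α + β) < ⊤ := by
    have := hμ.energy_lt_top
    rw [htv] at this
    exact crossEnergy_lt_top_of_energy_lt_top hC ha (α + β) this
  have hmom := integrable_norm_sq_of_rpow ha2 (integrable_norm_rpow_of_crossEnergy_lt_top hC ha hE)
  rw [integrable_add_measure] at hmom
  have hmass : α univ = β univ := by
    have h1 := hμ.mass_eq_zero
    rw [← μ.toSignedMeasure_toJordanDecomposition, JordanDecomposition.toSignedMeasure,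
      _root_.sub_apply, Measure.toSignedMeasure_apply_measurable MeasurableSet.univ,
      Measure.toSignedMeasure_apply_measurable MeasurableSet.univ, sub_eq_zero] at h1
    exact (ENNReal.toReal_eq_toReal_iff' (measure_ne_top _ _) (measure_ne_top _ _)).1 h1
  have hbal : IsBalanced α β := ⟨hmass, hmom.1, hmom.2, sub_eq_zero.1 hμ.center_eq_zero⟩
  have h1 := H α β hbal hE
  rw [signedEnergy_powerLaw]
  simp_rw [norm_fourier_eq]
  have hcont : Continuous fun v => ‖charFun α v - charFun β v‖ ^ 2 := by
    have h1 := continuous_charFun α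
    have h2 := continuous_charFun β
    fun_prop
  have hcpt : IsCompact {v : Rn d | ‖v‖ ≤ R} := by
    have := isCompact_closedBall (0 : Rn d) R
    simpa [Metric.closedBall, dist_zero_right] using this
  have h2 : ∫ v in {v : Rn d | r ≤ ‖v‖ ∧ ‖v‖ ≤ R}, ‖charFun α v - charFun β v‖ ^ 2 ≤
      ∫ v in {v : Rn d | ‖v‖ ≤ R}, ‖charFun α v - charFun β v‖ ^ 2 := by
    refine setIntegral_mono_set (hcont.continuousOn.integrableOn_compact hcpt)
      (ae_of_all _ fun v => by positivity) (LE.le.eventuallyLE fun v hv => hv.2)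
  rw [mul_assoc]
  gcongr
  refine le_trans ?_ h1
  gcongr

/-! ### Rotations -/

/-- Nearby vectors of the same norm are exchanged by an isometry close to the identity, namely the
product of the half-turns about `ξ` and about the bisector of `ξ` and `η`. -/
theorem exists_near_identity_isometry {κ : ℝ} (hκ : 0 < κ) {ξ : Rn d} (hξ : ξ ≠ 0) :
    ∀ᶠ η in 𝓝 ξ, ‖η‖ = ‖ξ‖ → ∃ Q : Rn d ≃ₗᵢ[ℝ] Rn d, Q ξ = η ∧ ∀ x, ‖Q x - x‖ ≤ κ * ‖x‖ := by
  -- `F w` is the orthogonal projection onto the line spanned by `w`.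
  set F : Rn d → (Rn d →L[ℝ] Rn d) := fun w =>
    (‖w‖ ^ 2)⁻¹ • ContinuousLinearMap.smulRightL ℝ (Rn d) (Rn d) (innerSL ℝ w) w with hF
  have hrefl : ∀ w y : Rn d, (Submodule.span ℝ {w}).reflection y = (2 : ℝ) • F w y - y := by
    intro w y
    rw [Submodule.reflection_singleton_apply]
    simp [hF, smul_smul, two_smul, div_eq_inv_mul, two_mul, add_smul]
  have h2 : (2 : ℝ) • ξ ≠ 0 := smul_ne_zero two_ne_zero hξ
  have hF2 : F ((2 : ℝ) • ξ) = F ξ := by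
    ext1 y
    have : ‖ξ‖ ≠ 0 := norm_ne_zero_iff.2 hξ
    simp only [hF, norm_smul, map_smul, Real.norm_ofNat, FunLike.coe_smul,
      Pi.smul_apply, smul_smul]
    congr 1
    field_simp
  have hcF : ContinuousAt F ((2 : ℝ) • ξ) := by
    have : ‖(2 : ℝ) • ξ‖ ^ 2 ≠ 0 := pow_ne_zero 2 (norm_ne_zero_iff.2 h2)
    simp only [hF]
    fun_prop (disch := assumption)
  have hadd : ContinuousAt (fun η : Rn d => ξ + η) ξ := by fun_prop
  have hc : Tendsto (fun η : Rn d => F (ξ + η)) (𝓝 ξ) (𝓝 (F ξ)) := by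
    rw [← hF2]
    exact Tendsto.comp (hcF.tendsto) (by rw [two_smul]; exact hadd)
  have hne : ∀ᶠ η in 𝓝 ξ, ξ + η ≠ 0 := by
    refine hadd.eventually_ne ?_
    rwa [← two_smul ℝ]
  filter_upwards [Metric.tendsto_nhds.1 hc (κ / 2) (by positivity), hne] with η h1 h3 hn
  rw [dist_eq_norm] at h1
  refine ⟨(Submodule.span ℝ {ξ}).reflection.trans (Submodule.span ℝ {ξ + η}).reflection, ?_, ?_⟩
  · rw [LinearIsometryEquiv.trans_apply, Submodule.reflection_mem_subspace_eq_self
      (Submodule.mem_span_singleton_self ξ), Submodule.reflection_singleton_apply]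
    have e : inner ℝ (ξ + η) ξ / (‖ξ + η‖ : ℝ) ^ 2 = (1 / 2 : ℝ) := by
      have h4 : ‖ξ + η‖ ^ 2 ≠ 0 := pow_ne_zero 2 (norm_ne_zero_iff.2 h3)
      rw [div_eq_div_iff h4 two_ne_zero, norm_add_sq_real, hn, inner_add_left,
        real_inner_self_eq_norm_sq, real_inner_comm]
      ring
    simp only [RCLike.ofReal_real_eq_id, id_eq]
    rw [e, two_smul, ← add_smul]
    norm_num
  · intro x
    set y := (Submodule.span ℝ {ξ}).reflection x with hy
    have hx : x = (Submodule.span ℝ {ξ}).reflection y := by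
      rw [hy, Submodule.reflection_reflection]
    have hyx : ‖y‖ = ‖x‖ := LinearIsometryEquiv.norm_map _ x
    rw [LinearIsometryEquiv.trans_apply, ← hy, ← hyx]
    rw [hx]
    rw [hrefl, hrefl, sub_sub_sub_cancel_right, ← smul_sub, ← _root_.sub_apply, norm_smul,
      Real.norm_ofNat]
    calc 2 * ‖(F (ξ + η) - F ξ) y‖ ≤ 2 * (‖F (ξ + η) - F ξ‖ * ‖y‖) := by
          gcongr
          exact ContinuousLinearMap.le_opNorm _ _
      _ ≤ 2 * (κ / 2 * ‖y‖) := by gcongr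
      _ = κ * ‖y‖ := by ring

theorem charFun_map_isometry (ρ : Measure (Rn d)) (Q : Rn d ≃ₗᵢ[ℝ] Rn d) (ξ : Rn d) :
    charFun (ρ.map Q) ξ = charFun ρ (Q.symm ξ) := by
  rw [charFun_apply, charFun_apply,
    integral_map Q.continuous.measurable.aemeasurable
      (Continuous.aestronglyMeasurable (by fun_prop))]
  simp_rw [LinearIsometryEquiv.inner_map_eq_flip]

/-- A measure which is invariant under the isometries close to the identity is invariant under
all isometries, because its characteristic function is locally constant on each sphere, hence
constant. -/
theorem map_isometry_eq_of_near_identity (hd : 2 ≤ d) (ρ : Measure (Rn d)) [IsFiniteMeasure ρ]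
    {κ : ℝ} (hκ : 0 < κ)
    (h : ∀ Q : Rn d ≃ₗᵢ[ℝ] Rn d, (∀ x, ‖Q x - x‖ ≤ κ * ‖x‖) → ρ.map Q = ρ)
    (Q : Rn d ≃ₗᵢ[ℝ] Rn d) : ρ.map Q = ρ := by
  have hrank : 1 < Module.rank ℝ (Rn d) := by
    rw [rank_eq_card_basis (EuclideanSpace.basisFun (Fin d) ℝ).toBasis, Fintype.card_fin]
    exact_mod_cast hd
  have hconst : ∀ ξ η : Rn d, ‖η‖ = ‖ξ‖ → charFun ρ ξ = charFun ρ η := by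
    intro ξ η hη
    rcases eq_or_ne ξ 0 with rfl | hξ
    · rw [norm_zero, norm_eq_zero] at hη
      rw [hη]
    refine (isPreconnected_sphere hrank (0 : Rn d) ‖ξ‖).induction₂
      (fun x y => charFun ρ x = charFun ρ y) ?_ (fun _ _ _ _ _ _ h1 h2 => h1.trans h2)
      (fun _ _ _ _ h1 => h1.symm) (by simp) (by simp [hη])
    intro x hx
    rw [mem_sphere_zero_iff_norm] at hx
    have hx0 : x ≠ 0 := norm_ne_zero_iff.1 (hx ▸ norm_ne_zero_iff.2 hξ)
    filter_upwards [mem_nhdsWithin_of_mem_nhds (exists_near_identity_isometry hκ hx0),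
      self_mem_nhdsWithin] with y hy hys
    rw [mem_sphere_zero_iff_norm] at hys
    obtain ⟨S, hS, hSκ⟩ := hy (hys.trans hx.symm)
    have := charFun_map_isometry ρ S y
    rw [h S hSκ, ← hS, LinearIsometryEquiv.symm_apply_apply, hS] at this
    exact this.symm
  have : IsFiniteMeasure (ρ.map Q) := Measure.isFiniteMeasure_map ρ Q
  refine Measure.ext_of_charFun (funext fun ξ => ?_)
  rw [charFun_map_isometry]
  exact hconst _ _ (by simp)

/-! ### Invariance of the energy -/

theorem shiftedPotential_congr (a b C : ℝ) {x y : Rn d} (h : ‖x‖ = ‖y‖) :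
    shiftedPotential d a b C x = shiftedPotential d a b C y := by
  have h0 : x = 0 ↔ y = 0 := by rw [← norm_eq_zero, h, norm_eq_zero]
  simp only [shiftedPotential, powerLaw, h, h0]

theorem crossEnergy_map_isometry (a b C : ℝ) (ρ : Measure (Rn d)) [SFinite ρ] {T : Rn d → Rn d}
    (hT : Isometry T) : crossEnergy a b C (ρ.map T) (ρ.map T) = crossEnergy a b C ρ ρ := by
  have hm := hT.continuous.measurable
  rw [crossEnergy, Measure.map_prod_map _ _ hm hm,
    lintegral_map (by fun_prop) (hm.prodMap hm), crossEnergy]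
  refine lintegral_congr fun z => shiftedPotential_congr a b C ?_
  rw [Prod.map_fst, Prod.map_snd, ← dist_eq_norm, ← dist_eq_norm, hT.dist_eq]

theorem isometry_rotation (c : Rn d) (Q : Rn d ≃ₗᵢ[ℝ] Rn d) :
    Isometry fun x => c + Q (x - c) :=
  Isometry.of_dist_eq fun x y => by simp

/-- Isometries around the center of mass preserve the center of mass. -/
theorem integral_map_rotation {ρ : Measure (Rn d)} [IsProbabilityMeasure ρ]
    (hρ : Integrable (fun x : Rn d => x) ρ) (Q : Rn d ≃ₗᵢ[ℝ] Rn d) :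
    ∫ x, x ∂ρ.map (fun x => centerOfMass ρ + Q (x - centerOfMass ρ)) = ∫ x, x ∂ρ := by
  have h1 : Integrable (fun x => x - centerOfMass ρ) ρ := hρ.sub (integrable_const _)
  have h2 : ∫ x, Q (x - centerOfMass ρ) ∂ρ = Q (∫ x, (x - centerOfMass ρ) ∂ρ) :=
    Q.toContinuousLinearEquiv.toContinuousLinearMap.integral_comp_comm h1
  have h3 : Integrable (fun x => Q (x - centerOfMass ρ)) ρ :=
    Q.toContinuousLinearEquiv.toContinuousLinearMap.integrable_comp h1
  rw [integral_map (isometry_rotation _ Q).continuous.measurable.aemeasurable (by fun_prop),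
    integral_add (integrable_const _) h3, h2, integral_sub hρ (integrable_const _)]
  simp [centerOfMass]

/-- Radial symmetry, read off from the measure translated to have its center of mass at the
origin. -/
theorem map_rotation_eq_iff (ρ : Measure (Rn d)) (c : Rn d) (Q : Rn d ≃ₗᵢ[ℝ] Rn d) :
    ρ.map (fun x => c + Q (x - c)) = ρ ↔
      (ρ.map (fun x => x - c)).map Q = ρ.map (fun x => x - c) := by
  have e1 : (ρ.map (fun x => x - c)).map Q =
      (ρ.map (fun x => c + Q (x - c))).map (fun x => x - c) := by
    rw [Measure.map_map (by fun_prop) (by fun_prop), Measure.map_map (by fun_prop) (by fun_prop)]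
    congr 1
    ext1 x
    simp
  rw [e1]
  refine ⟨fun h => by rw [h], fun h => ?_⟩
  have e2 : ∀ μ : Measure (Rn d), (μ.map (fun x => x - c)).map (fun x => x + c) = μ := by
    intro μ
    rw [Measure.map_map (by fun_prop) (by fun_prop)]
    convert! Measure.map_id
    ext1 x
    simp
  have h' := congrArg (fun μ : Measure (Rn d) => μ.map (fun x => x + c)) h
  rwa [e2, e2] at h'

section

/-! ### Measures of finite energy -/

theorem integrableOn_powerTerm_norm (hd : 1 ≤ d) {b : ℝ} (hb : -(d : ℝ) < b) (s : ℝ) :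
    IntegrableOn (fun x : Rn d => powerTerm b ‖x‖) (Metric.ball 0 s) := by
  have : Nonempty (Fin d) := ⟨⟨0, hd⟩⟩
  rw [integrableOn_fun_norm_addHaar, finrank_euclideanSpace_fin]
  rcases le_or_gt s 0 with hs | hs
  · rw [Ioo_eq_empty (not_lt.2 hs)]
    exact integrableOn_empty
  by_cases h0 : b = 0
  · have h1 : IntervalIntegrable (fun y : ℝ => y ^ (d - 1) * Real.log y) volume 0 s :=
      intervalIntegral.intervalIntegrable_log'.continuousOn_mul (by fun_prop)
    rw [intervalIntegrable_iff_integrableOn_Ioo_of_le hs.le] at h1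
    refine h1.congr_fun (fun y _ => ?_) measurableSet_Ioo
    simp [powerTerm, h0]
  · have h1 : IntervalIntegrable (fun y : ℝ => y ^ ((d : ℝ) - 1 + b)) volume 0 s :=
      intervalIntegral.intervalIntegrable_rpow' (by linarith)
    have h2 := h1.div_const b
    rw [intervalIntegrable_iff_integrableOn_Ioo_of_le hs.le] at h2
    refine h2.congr_fun (fun y hy => ?_) measurableSet_Ioo
    simp only [powerTerm, if_neg h0, smul_eq_mul]
    rw [Real.rpow_add hy.1, ← Real.rpow_natCast, Nat.cast_sub hd, Nat.cast_one, mul_div_assoc]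

theorem setLIntegral_shiftedPotential_lt_top (hd : 1 ≤ d) {a b : ℝ} (ha : 0 < a)
    (hb : -(d : ℝ) < b) (C s : ℝ) :
    ∫⁻ x in Metric.ball (0 : Rn d) s, shiftedPotential d a b C x < ⊤ := by
  have : Nonempty (Fin d) := ⟨⟨0, hd⟩⟩
  have ha' : -(d : ℝ) < a := by
    have : (0 : ℝ) ≤ d := by positivity
    linarith
  have hi : IntegrableOn (fun x : Rn d => regPotential a b 0 x + C) (Metric.ball 0 s) := by
    simp only [regPotential_zero]
    exact ((integrableOn_powerTerm_norm hd ha' s).sub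
      (integrableOn_powerTerm_norm hd hb s)).add
      (integrableOn_const measure_ball_lt_top.ne)
  refine lt_of_le_of_lt (lintegral_mono_ae ?_) hi.hasFiniteIntegral
  have h0 : ∀ᵐ x : Rn d, x ≠ 0 := by
    simp [ae_iff]
  filter_upwards [ae_restrict_of_ae h0] with x hx
  rw [shiftedPotential_of_not_sing a C fun h => hx h.1]
  exact Real.ofReal_le_enorm _

/-- The uniform probability measure on the ball of radius `η` around the origin. -/
def ballMeasure (d : ℕ) (η : ℝ) : Measure (Rn d) :=
  (volume (Metric.ball (0 : Rn d) η))⁻¹ • volume.restrict (Metric.ball 0 η)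

theorem isProbabilityMeasure_ballMeasure {η : ℝ} (hη : 0 < η) :
    IsProbabilityMeasure (ballMeasure d η) := by
  constructor
  rw [ballMeasure, Measure.smul_apply, Measure.restrict_apply_univ, smul_eq_mul]
  exact ENNReal.inv_mul_cancel (Metric.measure_ball_pos _ _ hη).ne' measure_ball_lt_top.ne

theorem ae_ballMeasure (η : ℝ) : ∀ᵐ v ∂ballMeasure d η, ‖v‖ < η := by
  refine Measure.ae_smul_measure ?_ _
  filter_upwards [ae_restrict_mem Metric.isOpen_ball.measurableSet] with v hv
  simpa using hv

/-- The convolution of `ρ` with the uniform probability measure on a ball. -/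
def smear (ρ : Measure (Rn d)) (η : ℝ) : Measure (Rn d) :=
  (ρ.prod (ballMeasure d η)).map fun z => z.1 + z.2

/-- Spreading out a measure with bounded support makes its energy finite, since the singularity of
the potential is locally integrable. -/
theorem crossEnergy_smear_lt_top (hd : 1 ≤ d) {a b : ℝ} (ha : 0 < a) (hb : -(d : ℝ) < b) (C : ℝ)
    (ρ : Measure (Rn d)) [IsProbabilityMeasure ρ] {r η : ℝ} (hη : 0 < η)
    (hr : ∀ᵐ x ∂ρ, ‖x‖ ≤ r) : crossEnergy a b C (smear ρ η) (smear ρ η) < ⊤ := by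
  have := isProbabilityMeasure_ballMeasure (d := d) hη
  set u := ballMeasure d η with hu
  have hprob : IsProbabilityMeasure (smear ρ η) :=
    Measure.isProbabilityMeasure_map (by fun_prop)
  set B := (volume (Metric.ball (0 : Rn d) η))⁻¹ *
    ∫⁻ x in Metric.ball (0 : Rn d) (η + 2 * r + η), shiftedPotential d a b C x with hB
  have hBtop : B < ⊤ := ENNReal.mul_lt_top
    (ENNReal.inv_lt_top.2 (Metric.measure_ball_pos _ _ hη))
    (setLIntegral_shiftedPotential_lt_top hd ha hb C _)
  have hinner : ∀ z : Rn d, ‖z‖ ≤ 2 * r + η →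
      ∫⁻ v, shiftedPotential d a b C (z + v) ∂u ≤ B := by
    intro z hz
    rw [hu, ballMeasure, lintegral_smul_measure, smul_eq_mul]
    refine mul_le_mul_right ?_ _
    rw [← lintegral_indicator Metric.isOpen_ball.measurableSet,
      ← lintegral_indicator Metric.isOpen_ball.measurableSet,
      ← lintegral_add_left_eq_self (μ := volume) (f := indicator
        (Metric.ball (0 : Rn d) (η + 2 * r + η)) (shiftedPotential d a b C)) z]
    refine lintegral_mono fun v => ?_
    by_cases hv : v ∈ Metric.ball (0 : Rn d) η
    · have hv' : z + v ∈ Metric.ball (0 : Rn d) (η + 2 * r + η) := by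
        rw [mem_ball_zero_iff] at hv ⊢
        have := norm_add_le z v
        linarith
      rw [indicator_of_mem hv, indicator_of_mem hv']
    · rw [indicator_of_notMem hv]
      exact zero_le
  have hsm : ∀ᵐ x ∂smear ρ η, ‖x‖ ≤ r + η := by
    rw [smear, ae_map_iff (by fun_prop) (measurableSet_le (by fun_prop) (by fun_prop))]
    have h1 : ∀ᵐ z ∂ρ.prod u, ‖z.1‖ ≤ r := Measure.quasiMeasurePreserving_fst.ae hr
    have h2 : ∀ᵐ z ∂ρ.prod u, ‖z.2‖ < η :=
      Measure.quasiMeasurePreserving_snd.ae (ae_ballMeasure η)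
    filter_upwards [h1, h2] with z h1 h2
    have := norm_add_le z.1 z.2
    linarith
  have hpot : ∀ x : Rn d, ‖x‖ ≤ r + η →
      ∫⁻ y, shiftedPotential d a b C (y - x) ∂smear ρ η ≤ B := by
    intro x hx
    rw [smear, lintegral_map (by fun_prop) (by fun_prop), lintegral_prod _ (by fun_prop)]
    calc _ ≤ ∫⁻ _, B ∂ρ := by
          refine lintegral_mono_ae ?_
          filter_upwards [hr] with y hy
          have := hinner (y - x) (by have := norm_sub_le y x; linarith)
          refine le_trans (le_of_eq (lintegral_congr fun v => ?_)) this
          congr 1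
          abel
      _ = B := by simp
  rw [crossEnergy, lintegral_prod_symm _ (by fun_prop)]
  calc _ ≤ ∫⁻ _, B ∂smear ρ η := by
        refine lintegral_mono_ae ?_
        filter_upwards [hsm] with x hx
        exact hpot x hx
    _ = B := by simp
    _ < ⊤ := hBtop

/-! ### Local minimizers -/

theorem dInfty_le {ρ ν : Measure (Rn d)} (π : Measure (Rn d × Rn d)) (h1 : π.fst = ρ)
    (h2 : π.snd = ν) {e : ℝ} (he : ∀ᵐ p ∂π, ‖p.1 - p.2‖ ≤ e) :
    dInfty ρ ν ≤ ENNReal.ofReal e := by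
  refine iInf_le_of_le π (iInf_le_of_le ⟨h1, h2⟩ (iSup₂_le fun p hp => ?_))
  have hcl : IsClosed {p : Rn d × Rn d | ‖p.1 - p.2‖ ≤ e} :=
    isClosed_le (by fun_prop) continuous_const
  have hp' : ‖p.1 - p.2‖ ≤ e := Measure.support_subset_of_isClosed hcl he hp
  rw [edist_dist, dist_eq_norm]
  exact ENNReal.ofReal_le_ofReal hp'

theorem isCompact_support_of_ae {ρ : Measure (Rn d)} {r : ℝ} (h : ∀ᵐ x ∂ρ, ‖x‖ ≤ r) :
    IsCompact ρ.support := by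
  refine (isCompact_closedBall (0 : Rn d) r).of_isClosed_subset Measure.isClosed_support
    (Measure.support_subset_of_isClosed Metric.isClosed_closedBall ?_)
  filter_upwards [h] with x hx
  simpa using hx

theorem exists_ae_norm_le {ρ : Measure (Rn d)} (h : IsCompact ρ.support) :
    ∃ r, 0 < r ∧ ∀ᵐ x ∂ρ, ‖x‖ ≤ r := by
  obtain ⟨r, hr0, hr⟩ := h.isBounded.exists_pos_norm_le
  refine ⟨r, hr0, ?_⟩
  filter_upwards [Measure.support_mem_ae (μ := ρ)] with x hx
  exact hr x hx

variable {a b C : ℝ}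

theorem crossEnergy_lt_top_of_isLocalMinimizer (hd : 1 ≤ d) (hC : IsShift a b C) (ha : 0 < a)
    (hb : -(d : ℝ) < b) {ρ : Measure (Rn d)}
    (hρ : IsCompactDInftyLocalMinimizer (powerLaw d a b) ρ) : crossEnergy a b C ρ ρ < ⊤ := by
  have := hρ.isProbabilityMeasure
  obtain ⟨r, hr0, hr⟩ := exists_ae_norm_le hρ.isCompact_support
  obtain ⟨ε, hε, hmin⟩ := hρ.le_energy
  have hη : 0 < ε / 2 := by positivity
  have := isProbabilityMeasure_ballMeasure (d := d) hη
  have hprob : IsProbabilityMeasure (smear ρ (ε / 2)) :=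
    Measure.isProbabilityMeasure_map (by fun_prop)
  have h1 : ∀ᵐ z ∂ρ.prod (ballMeasure d (ε / 2)), ‖z.1‖ ≤ r :=
    Measure.quasiMeasurePreserving_fst.ae hr
  have h2 : ∀ᵐ z ∂ρ.prod (ballMeasure d (ε / 2)), ‖z.2‖ < ε / 2 :=
    Measure.quasiMeasurePreserving_snd.ae (ae_ballMeasure _)
  have hsm : ∀ᵐ x ∂smear ρ (ε / 2), ‖x‖ ≤ r + ε / 2 := by
    rw [smear, ae_map_iff (by fun_prop) (measurableSet_le (by fun_prop) (by fun_prop))]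
    filter_upwards [h1, h2] with z h1 h2
    have := norm_add_le z.1 z.2
    linarith
  have hdist : dInfty ρ (smear ρ (ε / 2)) ≤ ENNReal.ofReal (ε / 2) := by
    refine dInfty_le ((ρ.prod (ballMeasure d (ε / 2))).map fun z => (z.1, z.1 + z.2)) ?_ ?_ ?_
    · rw [Measure.fst_map_prodMk (by fun_prop)]
      exact Measure.fst_prod
    · rw [Measure.snd_map_prodMk (by fun_prop)]
      rfl
    · rw [ae_map_iff (by fun_prop) (measurableSet_le (by fun_prop) (by fun_prop))]
      filter_upwards [h2] with z h2
      simpa using h2.le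
  have h3 := hmin _ hprob (isCompact_support_of_ae hsm)
    (lt_of_le_of_lt hdist ((ENNReal.ofReal_lt_ofReal_iff hε).2 (by linarith)))
  rw [energy_le_energy_iff hC ha] at h3
  exact lt_of_le_of_lt h3 (crossEnergy_smear_lt_top hd ha hb C ρ hη hr)

theorem isProbabilityMeasure_midpoint (ρ ν : Measure (Rn d)) [IsProbabilityMeasure ρ]
    [IsProbabilityMeasure ν] : IsProbabilityMeasure ((2⁻¹ : ℝ≥0∞) • (ρ + ν)) := by
  constructor
  rw [Measure.smul_apply, Measure.add_apply, measure_univ, measure_univ, one_add_one_eq_two,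
    smul_eq_mul]
  exact ENNReal.inv_mul_cancel two_ne_zero ENNReal.ofNat_ne_top

/-- A local minimizer is invariant under the isometries around its center of mass which are close
to the identity: otherwise the midpoint of the segment between the measure and its image, which is
close in `d_∞`, has less energy. -/
theorem exists_map_eq_of_near_identity (hd : 1 ≤ d) (hC : IsShift a b C) (ha2 : 2 ≤ a)
    (ha4 : a ≤ 4) (hdb : -(d : ℝ) < b) (hb : b < 2) {ρ : Measure (Rn d)}
    (hρ : IsCompactDInftyLocalMinimizer (powerLaw d a b) ρ) :
    ∃ κ : ℝ, 0 < κ ∧ ∀ Q : Rn d ≃ₗᵢ[ℝ] Rn d, (∀ x, ‖Q x - x‖ ≤ κ * ‖x‖) →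
      ρ.map (fun x => centerOfMass ρ + Q (x - centerOfMass ρ)) = ρ := by
  have ha : 0 < a := by linarith
  have := hρ.isProbabilityMeasure
  have hfin := crossEnergy_lt_top_of_isLocalMinimizer hd hC ha hdb hρ
  have hid : Integrable (fun x : Rn d => x) ρ := integrable_id_of_norm_sq
    (integrable_norm_sq_of_rpow ha2 (integrable_norm_rpow_of_crossEnergy_lt_top hC ha hfin))
  obtain ⟨r, hr0, hr⟩ := exists_ae_norm_le hρ.isCompact_support
  obtain ⟨ε, hε, hmin⟩ := hρ.le_energy
  set c := centerOfMass ρ with hc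
  set s := r + ‖c‖ with hs
  have hs0 : 0 < s := by positivity
  have hsc : ∀ᵐ x ∂ρ, ‖x - c‖ ≤ s := by
    filter_upwards [hr] with x hx
    exact (norm_sub_le x c).trans (by linarith)
  refine ⟨ε / (2 * s), by positivity, fun Q hQ => ?_⟩
  set T : Rn d → Rn d := fun x => c + Q (x - c) with hT
  have hTi : Isometry T := isometry_rotation c Q
  have hTm : Measurable T := hTi.continuous.measurable
  have hprob : IsProbabilityMeasure (ρ.map T) :=
    Measure.isProbabilityMeasure_map hTm.aemeasurable
  have hprob' := isProbabilityMeasure_midpoint ρ (ρ.map T)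
  have hmove : ∀ᵐ x ∂ρ, ‖x - T x‖ ≤ ε / 2 := by
    filter_upwards [hsc] with x hx
    have e : ‖x - T x‖ = ‖Q (x - c) - (x - c)‖ := by
      rw [norm_sub_rev]
      congr 1
      simp only [hT]
      abel
    rw [e]
    calc _ ≤ ε / (2 * s) * ‖x - c‖ := hQ _
      _ ≤ ε / (2 * s) * s := by gcongr
      _ = ε / 2 := by field_simp
  have hdist : dInfty ρ ((2⁻¹ : ℝ≥0∞) • (ρ + ρ.map T)) ≤ ENNReal.ofReal (ε / 2) := by
    refine dInfty_le ((2⁻¹ : ℝ≥0∞) • (ρ.map (fun x => (x, x)) + ρ.map (fun x => (x, T x))))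
      ?_ ?_ ?_
    · rw [Measure.fst, Measure.map_smul, Measure.map_add _ _ measurable_fst,
        ← Measure.fst, ← Measure.fst, Measure.fst_map_prodMk (by fun_prop),
        Measure.fst_map_prodMk hTm]
      change (2⁻¹ : ℝ≥0∞) • (ρ.map id + ρ.map id) = ρ
      rw [Measure.map_id, ← two_smul ℝ≥0∞ ρ, smul_smul,
        ENNReal.inv_mul_cancel two_ne_zero ENNReal.ofNat_ne_top, one_smul]
    · rw [Measure.snd, Measure.map_smul, Measure.map_add _ _ measurable_snd,
        ← Measure.snd, ← Measure.snd, Measure.snd_map_prodMk (by fun_prop),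
        Measure.snd_map_prodMk (by fun_prop)]
      change (2⁻¹ : ℝ≥0∞) • (ρ.map id + ρ.map T) = _
      rw [Measure.map_id]
    · refine Measure.ae_smul_measure ?_ _
      have hms : MeasurableSet {p : Rn d × Rn d | ‖p.1 - p.2‖ ≤ ε / 2} :=
        measurableSet_le (by fun_prop) (by fun_prop)
      rw [ae_add_measure_iff, ae_map_iff (by fun_prop) hms, ae_map_iff (by fun_prop) hms]
      refine ⟨ae_of_all _ fun x => ?_, hmove⟩
      rw [sub_self, norm_zero]
      positivity
  have hcpt : IsCompact ((2⁻¹ : ℝ≥0∞) • (ρ + ρ.map T)).support := by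
    refine isCompact_support_of_ae (r := r + ε / 2) (Measure.ae_smul_measure ?_ _)
    rw [ae_add_measure_iff, ae_map_iff hTm.aemeasurable
      (measurableSet_le (by fun_prop) (by fun_prop))]
    constructor
    · filter_upwards [hr] with x hx
      linarith
    · filter_upwards [hr, hmove] with x hx hx'
      have h1 := norm_sub_norm_le (T x) x
      rw [norm_sub_rev] at hx'
      linarith
  have h3 := hmin _ hprob' hcpt
    (lt_of_le_of_lt hdist ((ENNReal.ofReal_lt_ofReal_iff hε).2 (by linarith)))
  rw [energy_le_energy_iff hC ha] at h3
  exact (eq_of_crossEnergy_le_midpoint hC ha2 ha4 hb (integral_map_rotation hid Q).symm hfin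
    (crossEnergy_map_isometry a b C ρ hTi).le h3).symm

theorem isRadiallySymmetric_of_isLocalMinimizer (hd : 2 ≤ d) (hC : IsShift a b C) (ha2 : 2 ≤ a)
    (ha4 : a ≤ 4) (hdb : -(d : ℝ) < b) (hb : b < 2) {ρ : Measure (Rn d)}
    (hρ : IsCompactDInftyLocalMinimizer (powerLaw d a b) ρ) : IsRadiallySymmetric ρ := by
  have := hρ.isProbabilityMeasure
  obtain ⟨κ, hκ, h⟩ := exists_map_eq_of_near_identity (by omega) hC ha2 ha4 hdb hb hρ
  have hfin : IsFiniteMeasure (ρ.map fun x => x - centerOfMass ρ) :=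
    Measure.isFiniteMeasure_map _ _
  intro Q
  rw [map_rotation_eq_iff]
  refine map_isometry_eq_of_near_identity hd _ hκ (fun S hS => ?_) Q
  rw [← map_rotation_eq_iff]
  exact h S hS

end

section minimizers

variable {a b C : ℝ}

/-! ### Global minimizers -/

theorem isProbTwo_of_crossEnergy_lt_top (hC : IsShift a b C) (ha2 : 2 ≤ a) {ρ : Measure (Rn d)}
    [IsProbabilityMeasure ρ] (h : crossEnergy a b C ρ ρ < ⊤) : IsProbTwo ρ := by
  refine ⟨inferInstance, ?_⟩
  have h1 := (integrable_norm_sq_of_rpow ha2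
    (integrable_norm_rpow_of_crossEnergy_lt_top hC (by linarith) h)).hasFiniteIntegral
  refine lt_of_le_of_lt (lintegral_mono fun x => ?_) h1
  rw [enorm_pow, enorm_norm]

theorem isGlobalMinimizer_iff (hC : IsShift a b C) (ha2 : 2 ≤ a) {ρ : Measure (Rn d)} :
    IsGlobalMinimizer (powerLaw d a b) ρ ↔ IsProbTwo ρ ∧ ∀ ν : Measure (Rn d),
      IsProbabilityMeasure ν → crossEnergy a b C ρ ρ ≤ crossEnergy a b C ν ν := by
  have ha : 0 < a := by linarith
  refine and_congr_right fun hρ => ?_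
  have := hρ.isProbabilityMeasure
  constructor
  · intro h ν hν
    by_cases hfin : crossEnergy a b C ν ν = ⊤
    · rw [hfin]
      exact le_top
    · exact (energy_le_energy_iff hC ha ρ ν).1
        (h ν (isProbTwo_of_crossEnergy_lt_top hC ha2 (lt_top_iff_ne_top.2 hfin)))
  · intro h ν hν
    have := hν.isProbabilityMeasure
    exact (energy_le_energy_iff hC ha ρ ν).2 (h ν inferInstance)

theorem exists_crossEnergy_lt_top (hd : 1 ≤ d) (ha : 0 < a) (hdb : -(d : ℝ) < b) (C : ℝ) :
    ∃ ρ : Measure (Rn d), IsProbabilityMeasure ρ ∧ crossEnergy a b C ρ ρ < ⊤ := by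
  have := isProbabilityMeasure_ballMeasure (d := d) one_pos
  refine ⟨smear (Measure.dirac 0) 1, Measure.isProbabilityMeasure_map (by fun_prop),
    crossEnergy_smear_lt_top hd ha hdb C _ (r := 0) one_pos ?_⟩
  rw [ae_dirac_iff (measurableSet_le (by fun_prop) (by fun_prop))]
  simp

theorem IsGlobalMinimizer.crossEnergy_lt_top (hd : 1 ≤ d) (hC : IsShift a b C) (ha2 : 2 ≤ a)
    (hdb : -(d : ℝ) < b) {ρ : Measure (Rn d)} (hρ : IsGlobalMinimizer (powerLaw d a b) ρ) :
    crossEnergy a b C ρ ρ < ⊤ := by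
  obtain ⟨ν, hν, hfin⟩ := exists_crossEnergy_lt_top (a := a) hd (by linarith) hdb C
  exact lt_of_le_of_lt (((isGlobalMinimizer_iff hC ha2).1 hρ).2 ν hν) hfin

/-- Global minimizers with the same center of mass agree. -/
theorem IsGlobalMinimizer.eq (hd : 1 ≤ d) (hC : IsShift a b C) (ha2 : 2 ≤ a) (ha4 : a ≤ 4)
    (hdb : -(d : ℝ) < b) (hb : b < 2) {ρ ν : Measure (Rn d)}
    (hρ : IsGlobalMinimizer (powerLaw d a b) ρ) (hν : IsGlobalMinimizer (powerLaw d a b) ν)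
    (he : ∫ x, x ∂ρ = ∫ x, x ∂ν) : ρ = ν := by
  have hfin := hρ.crossEnergy_lt_top hd hC ha2 hdb
  have := hρ.1.isProbabilityMeasure
  have := hν.1.isProbabilityMeasure
  exact eq_of_crossEnergy_le_midpoint hC ha2 ha4 hb he hfin
    (((isGlobalMinimizer_iff hC ha2).1 hν).2 ρ inferInstance)
    (((isGlobalMinimizer_iff hC ha2).1 hρ).2 _ (isProbabilityMeasure_midpoint ρ ν))

theorem IsGlobalMinimizer.map_isometry (hd : 1 ≤ d) (hC : IsShift a b C) (ha2 : 2 ≤ a)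
    (hdb : -(d : ℝ) < b) {ρ : Measure (Rn d)}
    (hρ : IsGlobalMinimizer (powerLaw d a b) ρ) {T : Rn d → Rn d} (hT : Isometry T) :
    IsGlobalMinimizer (powerLaw d a b) (ρ.map T) := by
  have hfin := hρ.crossEnergy_lt_top hd hC ha2 hdb
  have := hρ.1.isProbabilityMeasure
  have : IsProbabilityMeasure (ρ.map T) :=
    Measure.isProbabilityMeasure_map hT.continuous.measurable.aemeasurable
  rw [isGlobalMinimizer_iff hC ha2, crossEnergy_map_isometry a b C ρ hT]
  refine ⟨isProbTwo_of_crossEnergy_lt_top hC ha2 ?_, ((isGlobalMinimizer_iff hC ha2).1 hρ).2⟩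
  rwa [crossEnergy_map_isometry a b C ρ hT]

theorem IsProbTwo.integrable_id {ρ : Measure (Rn d)} (hρ : IsProbTwo ρ) :
    Integrable (fun x : Rn d => x) ρ := by
  have := hρ.isProbabilityMeasure
  refine integrable_id_of_norm_sq ⟨by fun_prop, ?_⟩
  refine lt_of_le_of_lt (lintegral_mono fun x => ?_) hρ.second_moment_lt_top
  rw [enorm_pow, enorm_norm]

/-- The energy is invariant under isometries, so that uniqueness forces radial symmetry. -/
theorem isRadiallySymmetric_of_isGlobalMinimizer (hd : 1 ≤ d) (hC : IsShift a b C) (ha2 : 2 ≤ a)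
    (ha4 : a ≤ 4) (hdb : -(d : ℝ) < b) (hb : b < 2) {ρ : Measure (Rn d)}
    (hρ : IsGlobalMinimizer (powerLaw d a b) ρ) : IsRadiallySymmetric ρ := by
  have := hρ.1.isProbabilityMeasure
  intro Q
  exact (hρ.map_isometry hd hC ha2 hdb (isometry_rotation _ Q)).eq hd hC ha2 ha4 hdb hb hρ
    (integral_map_rotation hρ.1.integrable_id Q)

/-- For a centered measure the energy controls the second moment. -/
theorem lintegral_norm_sq_le (hC : IsShift a b C) (ha2 : 2 ≤ a) {ρ : Measure (Rn d)}
    [IsProbabilityMeasure ρ] (h : crossEnergy a b C ρ ρ < ⊤) (h0 : ∫ x, x ∂ρ = 0) :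
    ∫⁻ x, ‖x‖ₑ ^ 2 ∂ρ ≤ 1 + ENNReal.ofReal a * crossEnergy a b C ρ ρ := by
  have ha : 0 < a := by linarith
  have hi := integrable_norm_sq_of_rpow ha2 (integrable_norm_rpow_of_crossEnergy_lt_top hC ha h)
  have h1 := integral_norm_sq_sub hi hi
  rw [h0, inner_zero_left, probReal_univ] at h1
  have h2 : ∫ z, ‖z.1 - z.2‖ ^ 2 ∂ρ.prod ρ ≤
      ∫ z, (1 + 2 * a * (regPotential a b 0 (z.1 - z.2) + C)) ∂ρ.prod ρ := by
    refine integral_mono (integrable_norm_sq_sub hi hi) ((integrable_const _).add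
      ((integrable_regPotential_add hC ha h).const_mul (2 * a))) fun z => ?_
    have h3 := hC.2 d 0 (z.1 - z.2) le_rfl zero_le_one
    rw [div_le_iff₀ (by positivity)] at h3
    simp only
    rcases le_total ‖z.1 - z.2‖ 1 with h4 | h4
    · have : ‖z.1 - z.2‖ ^ 2 ≤ 1 := pow_le_one₀ (norm_nonneg _) h4
      have := Real.rpow_nonneg (norm_nonneg (z.1 - z.2)) a
      linarith
    · have := Real.rpow_le_rpow_of_exponent_le h4 ha2
      have e : ‖z.1 - z.2‖ ^ (2 : ℝ) = ‖z.1 - z.2‖ ^ 2 := by norm_cast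
      rw [e] at this
      linarith
  rw [integral_add (integrable_const _) ((integrable_regPotential_add hC ha h).const_mul (2 * a)),
    integral_const_mul, ← toReal_lintegral_shiftedPotential hC ha h, integral_const,
    probReal_univ, one_smul] at h2
  change _ ≤ 1 + 2 * a * (crossEnergy a b C ρ ρ).toReal at h2
  have h5 : ∫⁻ x, ‖x‖ₑ ^ 2 ∂ρ = ENNReal.ofReal (∫ x, ‖x‖ ^ 2 ∂ρ) := by
    rw [ofReal_integral_eq_lintegral_ofReal hi (ae_of_all _ fun x => by positivity)]
    refine lintegral_congr fun x => ?_
    rw [ENNReal.ofReal_pow (norm_nonneg x), ofReal_norm]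
  rw [h5, ← ENNReal.ofReal_toReal h.ne, ← ENNReal.ofReal_mul ha.le, ← ENNReal.ofReal_one,
    ← ENNReal.ofReal_add zero_le_one (by positivity)]
  exact ENNReal.ofReal_le_ofReal (by linarith)

/-- Lower semicontinuity of the energy under weak convergence. -/
theorem crossEnergy_le_liminf (hC : IsShift a b C) (ha : 0 < a)
    {ρ : ProbabilityMeasure (Rn d)} {ν : ℕ → ProbabilityMeasure (Rn d)}
    (h : Tendsto ν atTop (𝓝 ρ)) :
    crossEnergy a b C (ρ : Measure (Rn d)) ρ ≤
      liminf (fun n => crossEnergy a b C (ν n : Measure (Rn d)) (ν n)) atTop := by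
  have hprod : Tendsto (fun n => (ν n).prod (ν n)) atTop (𝓝 (ρ.prod ρ)) :=
    ((ProbabilityMeasure.continuous_prod).tendsto (ρ, ρ)).comp (h.prodMk_nhds h)
  have key : ∀ δ : ℝ, 0 < δ → δ ≤ 1 →
      ∫⁻ z, ENNReal.ofReal (regPotential a b δ (z.1 - z.2) + C)
          ∂(ρ : Measure (Rn d)).prod (ρ : Measure (Rn d)) ≤
        liminf (fun n => crossEnergy a b C (ν n : Measure (Rn d)) (ν n)) atTop := by
    intro δ h0 h1
    have hc : Continuous fun z : Rn d × Rn d => regPotential a b δ (z.1 - z.2) + C := by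
      have := continuous_regPotential (d := d) ha b h0
      fun_prop
    refine (lintegral_le_liminf_lintegral_of_forall_isOpen_measure_le_liminf_measure
      (μs := fun n => (ν n : Measure (Rn d)).prod (ν n : Measure (Rn d))) hc
      (fun z => hC.add_nonneg ha h0.le h1 (z.1 - z.2)) fun G hG => ?_).trans ?_
    · exact ProbabilityMeasure.le_liminf_measure_open_of_tendsto hprod hG
    · refine liminf_le_liminf (Eventually.of_forall fun n => lintegral_mono fun z => ?_)
      exact ofReal_regPotential_le a b C h0.le _
  set δ : ℕ → ℝ := fun n => 1 / ((n : ℝ) + 1) with hδ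
  have hδ0 : ∀ n, 0 < δ n := fun n => by simp only [hδ]; positivity
  have hδ1 : ∀ n, δ n ≤ 1 := fun n => by
    simp only [hδ]
    rw [div_le_one (by positivity)]
    have : (0 : ℝ) ≤ n := by positivity
    linarith
  have hlim : Tendsto δ atTop (𝓝 0) := tendsto_one_div_add_atTop_nhds_zero_nat
  calc crossEnergy a b C (ρ : Measure (Rn d)) ρ
      = ∫⁻ z, liminf (fun n => ENNReal.ofReal (regPotential a b (δ n) (z.1 - z.2) + C)) atTop
          ∂(ρ : Measure (Rn d)).prod (ρ : Measure (Rn d)) := by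
        refine lintegral_congr fun z => ?_
        exact ((tendsto_ofReal_regPotential a b C hδ0 hlim (z.1 - z.2)).liminf_eq).symm
    _ ≤ liminf (fun n => ∫⁻ z, ENNReal.ofReal (regPotential a b (δ n) (z.1 - z.2) + C)
          ∂(ρ : Measure (Rn d)).prod (ρ : Measure (Rn d))) atTop :=
        lintegral_liminf_le fun n => by fun_prop
    _ ≤ _ := by
        refine liminf_le_of_frequently_le' (Frequently.of_forall fun n => ?_)
        exact key (δ n) (hδ0 n) (hδ1 n)

theorem isTightMeasureSet_of_lintegral_norm_sq_le {S : Set (Measure (Rn d))} {M : ℝ≥0∞}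
    (hM : M ≠ ⊤) (h : ∀ μ ∈ S, ∫⁻ x, ‖x‖ₑ ^ 2 ∂μ ≤ M) : IsTightMeasureSet S := by
  refine isTightMeasureSet_of_tendsto_measure_norm_gt ?_
  have hlim : Tendsto (fun r : ℝ => M / ENNReal.ofReal r ^ 2) atTop (𝓝 0) := by
    have h1 : Tendsto (fun r : ℝ => ENNReal.ofReal r ^ 2) atTop (𝓝 ⊤) := by
      have := ENNReal.tendsto_ofReal_atTop
      have h2 := ENNReal.Tendsto.mul this (Or.inl ENNReal.top_ne_zero) this
        (Or.inl ENNReal.top_ne_zero)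
      simp_rw [← sq] at h2
      simpa using h2
    have := ENNReal.Tendsto.const_div h1 (Or.inr hM)
    simpa using this
  refine tendsto_of_tendsto_of_tendsto_of_le_of_le' tendsto_const_nhds hlim
    (Eventually.of_forall fun r => zero_le) ?_
  filter_upwards [eventually_gt_atTop (0 : ℝ)] with r hr
  refine iSup₂_le fun μ hμ => ?_
  have hr2 : ENNReal.ofReal r ^ 2 ≠ 0 := pow_ne_zero 2 (ENNReal.ofReal_pos.2 hr).ne'
  refine le_trans (measure_mono fun x hx => ?_) ((meas_ge_le_lintegral_div
    (f := fun x : Rn d => ‖x‖ₑ ^ 2) (by fun_prop) hr2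
    (ENNReal.pow_ne_top ENNReal.ofReal_ne_top)).trans ?_)
  · have hx' : r < ‖x‖ := hx
    change ENNReal.ofReal r ^ 2 ≤ ‖x‖ₑ ^ 2
    gcongr
    rw [← ofReal_norm]
    exact ENNReal.ofReal_le_ofReal hx'.le
  · gcongr
    exact h μ hμ

theorem isometry_sub_const (c : Rn d) : Isometry fun x : Rn d => x - c :=
  Isometry.of_dist_eq fun x y => by simp

theorem integral_map_sub_const {ρ : Measure (Rn d)} [IsProbabilityMeasure ρ]
    (h : Integrable (fun x : Rn d => x) ρ) : ∫ x, x ∂ρ.map (fun x => x - ∫ y, y ∂ρ) = 0 := by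
  rw [integral_map (by fun_prop) (by fun_prop), integral_sub h (integrable_const _)]
  simp

/-- The direct method: a minimizing sequence, centered at the origin, is tight. -/
theorem exists_isGlobalMinimizer (hd : 1 ≤ d) (hC : IsShift a b C) (ha2 : 2 ≤ a)
    (hdb : -(d : ℝ) < b) :
    ∃ ρ : Measure (Rn d), IsGlobalMinimizer (powerLaw d a b) ρ := by
  have ha : 0 < a := by linarith
  obtain ⟨ν₀, hν₀, hfin₀⟩ := exists_crossEnergy_lt_top (a := a) hd ha hdb C
  set E : Set ℝ≥0∞ := {e | ∃ ν : Measure (Rn d), IsProbabilityMeasure ν ∧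
    crossEnergy a b C ν ν = e} with hE
  obtain ⟨e, he_anti, he_lim, he_mem⟩ := exists_seq_tendsto_sInf (S := E) ⟨_, ν₀, hν₀, rfl⟩
    (OrderBot.bddBelow _)
  have hm : sInf E < ⊤ := lt_of_le_of_lt (sInf_le ⟨ν₀, hν₀, rfl⟩) hfin₀
  obtain ⟨N, hN⟩ := (he_lim.eventually (gt_mem_nhds hm)).exists
  -- Each term of the tail of the sequence is realized by a centered measure.
  have hcent : ∀ n, ∃ ν : ProbabilityMeasure (Rn d),
      crossEnergy a b C (ν : Measure (Rn d)) ν = e (n + N) ∧ ∫ x, x ∂(ν : Measure (Rn d)) = 0 := by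
    intro n
    obtain ⟨ν, hν, hνe⟩ := he_mem (n + N)
    have hfin : crossEnergy a b C ν ν < ⊤ := by
      rw [hνe]
      exact lt_of_le_of_lt (he_anti (Nat.le_add_left N n)) hN
    refine ⟨⟨ν.map (fun x => x - ∫ y, y ∂ν), Measure.isProbabilityMeasure_map (by fun_prop)⟩,
      ?_, ?_⟩
    · rw [← hνe]
      exact crossEnergy_map_isometry a b C ν (isometry_sub_const _)
    · exact integral_map_sub_const (isProbTwo_of_crossEnergy_lt_top hC ha2 hfin).integrable_id
  choose ν hν hν0 using hcent
  have hfin : ∀ n, crossEnergy a b C (ν n : Measure (Rn d)) (ν n) ≤ e N := fun n => by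
    rw [hν]
    exact he_anti (Nat.le_add_left N n)
  have htight : IsTightMeasureSet {((μ : ProbabilityMeasure (Rn d)) : Measure (Rn d)) |
      μ ∈ range ν} := by
    refine isTightMeasureSet_of_lintegral_norm_sq_le (M := 1 + ENNReal.ofReal a * e N)
      (ENNReal.add_lt_top.2 ⟨ENNReal.one_lt_top,
        ENNReal.mul_lt_top ENNReal.ofReal_lt_top hN⟩).ne ?_
    rintro _ ⟨_, ⟨n, rfl⟩, rfl⟩
    refine (lintegral_norm_sq_le hC ha2 (lt_of_le_of_lt (hfin n) hN) (hν0 n)).trans ?_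
    gcongr
    exact hfin n
  obtain ⟨ρ, -, φ, hφ, hlim⟩ := (isCompact_closure_of_isTightMeasureSet htight).tendsto_subseq
    (x := ν) fun n => subset_closure (mem_range_self n)
  have hle : crossEnergy a b C (ρ : Measure (Rn d)) ρ ≤ sInf E := by
    refine (crossEnergy_le_liminf hC ha hlim).trans (le_of_eq ?_)
    refine Tendsto.liminf_eq ?_
    simp only [Function.comp_apply, hν]
    exact ((tendsto_add_atTop_iff_nat N).2 he_lim).comp hφ.tendsto_atTop
  refine ⟨ρ, (isGlobalMinimizer_iff hC ha2).2
    ⟨isProbTwo_of_crossEnergy_lt_top hC ha2 (lt_of_le_of_lt hle hm), fun μ hμ => ?_⟩⟩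
  exact hle.trans (sInf_le ⟨μ, hμ, rfl⟩)

theorem existsUnique_isGlobalMinimizer (hd : 1 ≤ d) (hC : IsShift a b C) (ha2 : 2 ≤ a)
    (ha4 : a ≤ 4) (hdb : -(d : ℝ) < b) (hb : b < 2) :
    ∃! ρ : Measure (Rn d), IsGlobalMinimizer (powerLaw d a b) ρ ∧ centerOfMass ρ = 0 := by
  obtain ⟨ρ, hρ⟩ := exists_isGlobalMinimizer (b := b) hd hC ha2 hdb
  have := hρ.1.isProbabilityMeasure
  refine ⟨ρ.map fun x => x - ∫ y, y ∂ρ,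
    ⟨hρ.map_isometry hd hC ha2 hdb (isometry_sub_const _),
      integral_map_sub_const hρ.1.integrable_id⟩, fun ν hν => ?_⟩
  refine hν.1.eq hd hC ha2 ha4 hdb hb (hρ.map_isometry hd hC ha2 hdb (isometry_sub_const _)) ?_
  rw [integral_map_sub_const hρ.1.integrable_id]
  exact hν.2

end minimizers

end InteractionEnergy

end

theorem mainTheorem4 (d : ℕ) (hd : 1 ≤ d) (a b : ℝ) (hdb : -(d : ℝ) < b) (hb : b < 2)
    (ha2 : 2 ≤ a) (ha4 : a ≤ 4) :
    (¬ (d = 1 ∧ 0 ≤ b ∧ b < 1) →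
      InteractionEnergy.IsFLIC (InteractionEnergy.powerLaw d a b)) ∧
    (2 ≤ d →
      (∀ ρ : Measure (InteractionEnergy.Rn d),
        InteractionEnergy.IsCompactDInftyLocalMinimizer (InteractionEnergy.powerLaw d a b) ρ →
          InteractionEnergy.IsRadiallySymmetric ρ) ∧
      (∃! ρ : Measure (InteractionEnergy.Rn d),
        InteractionEnergy.IsGlobalMinimizer (InteractionEnergy.powerLaw d a b) ρ ∧
          InteractionEnergy.centerOfMass ρ = 0) ∧
      (∀ ρ : Measure (InteractionEnergy.Rn d),
        InteractionEnergy.IsGlobalMinimizer (InteractionEnergy.powerLaw d a b) ρ →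
          InteractionEnergy.IsRadiallySymmetric ρ)) := by
  obtain ⟨C, hC⟩ := InteractionEnergy.exists_le_regPotential (a := a) (b := b) (by linarith)
    (by linarith)
  have hC' : InteractionEnergy.IsShift a b C := hC
  exact ⟨fun _ => InteractionEnergy.isFLIC_powerLaw hC' ha2 ha4 hb, fun hd2 =>
    ⟨fun ρ hρ =>
        InteractionEnergy.isRadiallySymmetric_of_isLocalMinimizer hd2 hC' ha2 ha4 hdb hb hρ,
      InteractionEnergy.existsUnique_isGlobalMinimizer hd hC' ha2 ha4 hdb hb,
      fun ρ hρ =>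
        InteractionEnergy.isRadiallySymmetric_of_isGlobalMinimizer hd hC' ha2 ha4 hdb hb hρ⟩⟩
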